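/- Let $\mathbb K$ be an algebraically closed field of characteristic $0$ and let $N\ge 0$. Write $E_{ij}$ for the matrix units of $\mathfrak{gl}_N=\mathfrak{gl}_N(\mathbb K)$, and in $U(\mathfrak{gl}_N)$ put $$\Omega_1=\sum_{i=1}^N E_{ii},\qquad \widehat\Omega_k=\sum_{i\in\{1,\dots,N\}^k}\ \sum_{\sigma\in S_k}E_{i_{\sigma(1)}i_1}E_{i_{\sigma(2)}i_2}\cdots E_{i_{\sigma(k)}i_k},\qquad P_k=\widehat\Omega_k-\frac{(N+k-1)!}{N!}\,\Omega_1 .$$ Let $X\subset\mathbb A^n_{\mathbb K}$ be a smooth irreducible affine variety of dimension $N$, $\mathcal A$ its algebra of polynomial functions, $\mathcal V=\mathrm{Der}(\mathcal A)$, and let $g_1,\dots,g_m$ generate the ideal of $X$. An $\mathcal A\mathcal V$-module is a vector space $M$ that is a module over the algebra $\mathcal A$ and over the Lie algebra $\mathcal V$ with $\eta(fm)=\eta(f)m+f(\eta m)$. A chart of the standard atlas of $X$ is given by a non-zero minor $h\in\mathcal A$ of size $n-N$ of the Jacobian matrix $(\partial g_j/\partial x_i)$; its parameters $t_1,\dots,t_N$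 are the coordinates $x_i$ whose columns are not used in $h$, and $\partial/\partial t_1,\dots,\partial/\partial t_N$ denote the derivations of $\mathcal A_{(h)}$ with $\partial t_j/\partial t_i=\delta_{ij}$. Let $(U,\rho)$ be a finite-dimensional simple $\mathfrak{gl}_N$-module. Gauge fields are $\mathcal A_{(h)}$-linear operators $B_1,\dots,B_N$ on $\mathcal A_{(h)}\otimes U$ that commute with $\rho(\mathfrak{gl}_N)$ and satisfy $[\partial/\partial t_i+B_i,\ \partial/\partial t_j+B_j]=0$ for all $i,j$. They make $\mathcal A_{(h)}\otimes U$ an $\mathcal A\mathcal V$-module, where $\eta=\sum_i f_i\,\partial/\partial t_i$, $f_i=\eta(t_i)$, acts through $$\Big(f\frac{\partial}{\partial t_i}\Big)(g\otimes u)=f\frac{\partial g}{\partial t_i}\otimes u+f\,B_i(g\otimes u)+\sum_{p=1}^N g\frac{\partial f}{\partial t_p}\otimes\rho(E_{pi})u .$$ An $\mathcal A\mathcal V$-module $M$ is a gauge module corresponding to $U$ if for each chart of the standard atlas it is isomorphic to an $\mathcal A\mathcal V$-submodule of $\mathcal A_{(h)}\otimes U$ (for some gauge fields) that is finitely generated over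 $\mathcal A$. Call a finite-dimensional simple $\mathfrak{gl}_N$-module $U$ exceptional if, for some $X$ of dimension $N$ as above, some gauge module corresponding to $U$ is simple as an $\mathcal A\mathcal V$-module but reducible as a $\mathcal V$-module. Then there are at most $N+1$ isomorphism classes of exceptional $\mathfrak{gl}_N$-modules. Moreover there are characters $\chi_0,\dots,\chi_N$ of the centre of $U(\mathfrak{gl}_N)$ such that, for every exceptional $U$, all $P_k$ with $k\ge 2$ act on $U$ by zero, $\Omega_1$ acts on $U$ by a scalar $a\in\{0,1,\dots,N\}$, and $\chi_a$ is the central character of $U$. -/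

import Mathlib

open scoped TensorProduct

attribute [local instance 100] LieRing.ofAssociativeRing

universe u v w

namespace GaugeModules

noncomputable section

/-! ### The Lie algebra `gl_N` and elements of its universal enveloping algebra -/

/-- The Lie algebra `gl_N` over `K`, with the commutator bracket of matrices. -/
abbrev Gl (K : Type u) [Field K] (N : ℕ) : Type u := Matrix (Fin N) (Fin N) K

/-- The universal enveloping algebra `U(gl_N)`. -/
abbrev UGl (K : Type u) [Field K] (N : ℕ) : Type u := UniversalEnvelopingAlgebra K (Gl K N)

/-- The matrix unit `E_{ij}`. -/
def matrixUnit (K : Type u) [Field K] (N : ℕ) (i j : Fin N) : Gl K N := Matrix.single i j (1 : K)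

/-- The matrix unit `E_{ij}` as an element of `U(gl_N)`. -/
def unitU (K : Type u) [Field K] (N : ℕ) (i j : Fin N) : UGl K N :=
  UniversalEnvelopingAlgebra.ι K (matrixUnit K N i j)

/-- `Ω₁ = ∑ᵢ E_{ii}`. -/
def Omega1 (K : Type u) [Field K] (N : ℕ) : UGl K N := ∑ i : Fin N, unitU K N i i

/-- `Ω̂ₖ = ∑_{i ∈ {1,…,N}^k} ∑_{σ ∈ S_k} E_{i_{σ(1)} i_1} E_{i_{σ(2)} i_2} ⋯ E_{i_{σ(k)} i_k}`. -/
def OmegaHat (K : Type u) [Field K] (N k : ℕ) : UGl K N :=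
  ∑ i : Fin k → Fin N, ∑ σ : Equiv.Perm (Fin k),
    (List.ofFn fun l : Fin k => unitU K N (i (σ l)) (i l)).prod

/-- `Pₖ = Ω̂ₖ - ((N+k-1)!/N!) Ω₁` (used for `k ≥ 2`, where `N + k - 1` is the honest number). -/
def P (K : Type u) [Field K] (N k : ℕ) : UGl K N :=
  OmegaHat K N k - (((N + k - 1).factorial : K) / (N.factorial : K)) • Omega1 K N

section Representations

variable (K : Type u) [Field K] (N : ℕ)
variable (U : Type v) [AddCommGroup U] [Module K U] [LieRingModule (Gl K N) U]
  [LieModule K (Gl K N) U]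

/-- The action of `U(gl_N)` on a `gl_N`-module. -/
def actU : UGl K N →ₐ[K] Module.End K U :=
  UniversalEnvelopingAlgebra.lift K (LieModule.toEnd K (Gl K N) U)

/-- `z` acts on `U` as multiplication by the scalar `c`. -/
def ActsByScalar (z : UGl K N) (c : K) : Prop := ∀ x : U, actU K N U z x = c • x

/-- `χ` is the central character of `U`: each central `z ∈ U(gl_N)` acts on `U` by `χ z`. -/
def HasCentralCharacter (χ : Subalgebra.center K (UGl K N) →ₐ[K] K) : Prop :=
  ∀ z : Subalgebra.center K (UGl K N), ActsByScalar K N U (z : UGl K N) (χ z)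

end Representations

/-! ### Smooth irreducible affine varieties and their standard atlas -/

/-- A smooth irreducible affine variety `X ⊆ 𝔸ⁿ` of dimension `N`, with chosen generators
`g₁, …, g_m` of the ideal of polynomials vanishing on `X`. Smoothness means that the Jacobian
matrix of the generators has rank `n - N` at every point of `X`. -/
structure SmoothAffineVariety (K : Type u) [Field K] (n m N : ℕ) where
  /-- the set of points -/
  X : Set (Fin n → K)
  /-- the generators of the vanishing ideal -/
  g : Fin m → MvPolynomial (Fin n) K
  isClosed : MvPolynomial.zeroLocus K (MvPolynomial.vanishingIdeal K X) = X
  irreducible : (MvPolynomial.vanishingIdeal K X).IsPrime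
  span_g : Ideal.span (Set.range g) = MvPolynomial.vanishingIdeal K X
  dim : ringKrullDim (MvPolynomial (Fin n) K ⧸ MvPolynomial.vanishingIdeal K X) = N
  smooth : ∀ p ∈ X,
    (Matrix.of fun (j : Fin m) (i : Fin n) =>
      MvPolynomial.eval p (MvPolynomial.pderiv i (g j))).rank + N = n

namespace SmoothAffineVariety

variable {K : Type u} [Field K] {n m N : ℕ} (V : SmoothAffineVariety K n m N)

/-- The algebra `A` of polynomial functions on the variety. -/
abbrev A : Type u := MvPolynomial (Fin n) K ⧸ MvPolynomial.vanishingIdeal K V.X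

/-- The Lie algebra of vector fields `Der(A)`. -/
abbrev Vect : Type u := Derivation K V.A V.A

/-- The coordinate function `x_i ∈ A`. -/
def coord (i : Fin n) : V.A := Ideal.Quotient.mk _ (MvPolynomial.X i)

/-- The Jacobian matrix `(∂g_j/∂x_i)` with entries in `A`. -/
def jacobian : Matrix (Fin m) (Fin n) V.A :=
  Matrix.of fun j i => Ideal.Quotient.mk _ (MvPolynomial.pderiv i (V.g j))

/-- A chart of the standard atlas: a non-zero `r × r` minor of the Jacobian matrix, where
`r = n - N` is its rank. `row` and `col` enumerate the rows and the columns of the minor,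
and `par` enumerates the remaining columns, whose coordinates are the chart parameters. -/
structure Chart where
  row : Fin (n - N) ↪o Fin m
  col : Fin (n - N) ↪o Fin n
  par : Fin N ↪o Fin n
  isCompl : IsCompl (Set.range par) (Set.range col)
  ne_zero : (V.jacobian.submatrix row col).det ≠ 0

namespace Chart

variable {V} (C : V.Chart)

/-- The minor `h` that defines the chart `N(h) = {h ≠ 0}`. -/
def h : V.A := (V.jacobian.submatrix C.row C.col).det

/-- The localized algebra `A_(h)`. -/
abbrev Ah : Type u := Localization.Away C.h

/-- The chart parameter `t_i ∈ A`. -/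
def t (i : Fin N) : V.A := V.coord (C.par i)

/-- `D i` is the derivation `∂/∂t_i` of `A_(h)`: the (unique) one with `D i (t_j) = δ_{ij}`. -/
def IsPartials (D : Fin N → Derivation K C.Ah C.Ah) : Prop :=
  ∀ i j, D i (algebraMap V.A C.Ah (C.t j)) = if i = j then 1 else 0

variable {U : Type v} [AddCommGroup U] [Module K U] [LieRingModule (Gl K N) U]
  [LieModule K (Gl K N) U]

/-- The operator `1 ⊗ ρ(x)` on `A_(h) ⊗ U`. -/
def rho (x : Gl K N) : C.Ah ⊗[K] U →ₗ[K] C.Ah ⊗[K] U :=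
  (LieModule.toEnd K (Gl K N) U x).lTensor C.Ah

/-- The operator `∂/∂t_i + B_i` on `A_(h) ⊗ U`. -/
def nabla (D : Fin N → Derivation K C.Ah C.Ah)
    (B : Fin N → C.Ah ⊗[K] U →ₗ[C.Ah] C.Ah ⊗[K] U) (i : Fin N) :
    C.Ah ⊗[K] U →ₗ[K] C.Ah ⊗[K] U :=
  LinearMap.rTensor U (D i : C.Ah →ₗ[K] C.Ah) + (B i).restrictScalars K

/-- Gauge fields on `A_(h) ⊗ U`, for a `gl_N`-module `U` (on which the elements of positive degree
of `Der(K[t_1,…,t_N])` act by zero): `A_(h)`-linear operators `B_i` that commute with `gl_N` and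
for which the operators `∂/∂t_i + B_i` commute with each other. -/
structure IsGaugeFields (D : Fin N → Derivation K C.Ah C.Ah)
    (B : Fin N → C.Ah ⊗[K] U →ₗ[C.Ah] C.Ah ⊗[K] U) : Prop where
  comm_rho : ∀ (i : Fin N) (x : Gl K N) (y : C.Ah ⊗[K] U), B i (C.rho x y) = C.rho x (B i y)
  flat : ∀ (i j : Fin N) (y : C.Ah ⊗[K] U),
    C.nabla D B i (C.nabla D B j y) = C.nabla D B j (C.nabla D B i y)

/-- The action of a vector field `η = ∑ᵢ fᵢ ∂/∂t_i`, `fᵢ = η(t_i)`, on `A_(h) ⊗ U`: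
`(f ∂/∂t_i)(g ⊗ u) = f ∂g/∂t_i ⊗ u + f B_i(g ⊗ u) + ∑_p (g ∂f/∂t_p) ⊗ ρ(E_{pi}) u`. -/
def gaugeAct (D : Fin N → Derivation K C.Ah C.Ah)
    (B : Fin N → C.Ah ⊗[K] U →ₗ[C.Ah] C.Ah ⊗[K] U) (η : V.Vect) (y : C.Ah ⊗[K] U) :
    C.Ah ⊗[K] U :=
  ∑ i : Fin N, (algebraMap V.A C.Ah (η (C.t i)) • C.nabla D B i y +
    ∑ p : Fin N, D p (algebraMap V.A C.Ah (η (C.t i))) • C.rho (matrixUnit K N p i) y)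

end Chart

/-! ### `AV`-modules and gauge modules -/

section AVModules

variable (M : Type w) [AddCommGroup M] [Module K M] [Module V.A M] [LieRingModule V.Vect M]

/-- An `AV`-module: a module over the algebra `A` and over the Lie algebra `Der(A)`
with `η·(f·m) = η(f)·m + f·(η·m)`. -/
structure IsAVModule : Prop where
  isScalarTower : IsScalarTower K V.A M
  lieModule : LieModule K V.Vect M
  leibniz : ∀ (η : V.Vect) (f : V.A) (x : M), ⁅η, f • x⁆ = η f • x + f • ⁅η, x⁆

/-- `M` is simple as an `AV`-module. -/
def IsSimpleAV : Prop :=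
  Nontrivial M ∧ ∀ W : Submodule V.A M,
    (∀ (η : V.Vect), ∀ x ∈ W, ⁅η, x⁆ ∈ W) → W = ⊥ ∨ W = ⊤

/-- `M` is reducible as a module over the Lie algebra of vector fields:
it has an invariant `K`-subspace that is neither zero nor everything. -/
def IsReducibleVect : Prop :=
  ∃ W : Submodule K M, (∀ (η : V.Vect), ∀ x ∈ W, ⁅η, x⁆ ∈ W) ∧ W ≠ ⊥ ∧ W ≠ ⊤

variable (U : Type v) [AddCommGroup U] [Module K U] [LieRingModule (Gl K N) U]
  [LieModule K (Gl K N) U]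

/-- `M` is a gauge module corresponding to the `gl_N`-module `U`: an `AV`-module that is isomorphic,
for each chart `N(h)` of the standard atlas, to a local gauge module, that is, to an `AV`-submodule
`L` of `A_(h) ⊗ U` (for some gauge fields) that is finitely generated over `A`. -/
structure IsGaugeModule : Prop where
  isAVModule : V.IsAVModule M
  isLocal : ∀ C : V.Chart,
    ∃ D : Fin N → Derivation K C.Ah C.Ah, C.IsPartials D ∧
    ∃ B : Fin N → C.Ah ⊗[K] U →ₗ[C.Ah] C.Ah ⊗[K] U, C.IsGaugeFields D B ∧
    ∃ L : Submodule V.A (C.Ah ⊗[K] U), L.FG ∧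
      (∀ η : V.Vect, ∀ y ∈ L, C.gaugeAct D B η y ∈ L) ∧
      ∃ e : M ≃ₗ[V.A] L, ∀ (η : V.Vect) (x : M),
        ((e ⁅η, x⁆ : L) : C.Ah ⊗[K] U) = C.gaugeAct D B η (e x)

end AVModules

end SmoothAffineVariety

/-! ### Exceptional simple `gl_N`-modules -/

/-- A simple finite-dimensional `gl_N`-module. -/
structure SimpleGlModule (K : Type u) [Field K] (N : ℕ) where
  carrier : Type v
  [addCommGroup : AddCommGroup carrier]
  [module : Module K carrier]
  [lieRingModule : LieRingModule (Gl K N) carrier]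
  [lieModule : LieModule K (Gl K N) carrier]
  finiteDimensional : FiniteDimensional K carrier
  irreducible : LieModule.IsIrreducible K (Gl K N) carrier

attribute [instance] SimpleGlModule.addCommGroup SimpleGlModule.module
  SimpleGlModule.lieRingModule SimpleGlModule.lieModule

namespace SimpleGlModule

variable {K : Type u} [Field K] {N : ℕ}

/-- Isomorphism of `gl_N`-modules, as an equivalence relation. -/
instance isoSetoid (K : Type u) [Field K] (N : ℕ) : Setoid (SimpleGlModule.{u, v} K N) where
  r U W := Nonempty (U.carrier ≃ₗ⁅K, Gl K N⁆ W.carrier)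
  iseqv :=
    { refl := fun _ => ⟨LieModuleEquiv.refl⟩
      symm := fun ⟨e⟩ => ⟨e.symm⟩
      trans := fun ⟨e⟩ ⟨f⟩ => ⟨e.trans f⟩ }

/-- `U` is exceptional: on some smooth irreducible affine variety of dimension `N` there is a
simple gauge `AV`-module corresponding to `U` that is reducible over the vector fields. -/
def IsExceptional (U : SimpleGlModule.{u, v} K N) : Prop :=
  ∃ (n m : ℕ) (V : SmoothAffineVariety K n m N)
    (M : Type w) (_ : AddCommGroup M) (_ : Module K M) (_ : Module V.A M)
    (_ : LieRingModule V.Vect M),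
    V.IsGaugeModule M U.carrier ∧ V.IsSimpleAV M ∧ V.IsReducibleVect M

/-- The isomorphism classes of exceptional simple finite-dimensional `gl_N`-modules. -/
def exceptionalClasses (K : Type u) [Field K] (N : ℕ) :
    Set (Quotient (isoSetoid.{u, v} K N)) :=
  {c | ∃ U : SimpleGlModule.{u, v} K N, IsExceptional.{u, v, w} U ∧ Quotient.mk _ U = c}

end SimpleGlModule

end

end GaugeModules

/-!
# Exceptional `gl_N`-modules are exterior powers

The whole theorem follows from one family of relations on an exceptional module `U`:
`E_{pi}E_{qj} + E_{qi}E_{pj} = δ_{ip}E_{qj} + δ_{iq}E_{pj}` (`ExteriorRelations`), which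
characterise the exterior powers of the natural module `K^N`.

*Why the relations hold.* Let `M ⊆ A_(h) ⊗ U` be a simple gauge module with a proper non-zero
subspace `W` that is invariant under vector fields. A product `(F ∂/∂t_i)(G ∂/∂t_j)` acts on `M` as
a differential operator that depends bilinearly on `F` and `G`. Its second difference in the
functions `t_p` and `t_q` contains no derivatives of the sections: it is `F G` times the constant
operator `T = δ_{ip}E_{qj} + δ_{iq}E_{pj} - E_{pi}E_{qj} - E_{qi}E_{pj}`
(`Chart.localAct_second_difference`). As `F` is arbitrary up to a fixed denominator, `W` contains
the `A`-submodule generated by `s T w`, for all `w ∈ W` and some invertible `s`. The largest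
`A`-submodule inside `W` is an `AV`-submodule of `M`, so it is zero and `T` kills `W`; then `T` kills
the `A`-span of `W`, which is all of `M` (`linearMap_eq_zero_of_isReducibleVect`). Finally `A_(h) M`
is `gl_N`-invariant, and its components along a basis of `A_(h)` are submodules of `U`, so `T` kills
the simple module `U`.

*What the relations imply.* Symmetrising the first two factors of `Ω̂ₖ₊₁` contracts an index and
gives `Ω̂ₖ₊₁ = (N + k) Ω̂ₖ`, hence `Pₖ = 0` (`actsByScalar_P`). Each `E_{pp}` is idempotent, so the
weights of `U` are subsets `S` of the index set, and a weight with minimal sum is an initial segment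
that carries a highest weight vector (`ExteriorRelations.exists_isHighestWeightVector`). Therefore
`Ω₁` acts by `a = |S| ∈ {0, …, N}`, and `a` determines the highest weight, hence the module: for two
simple modules, the submodule of their product generated by the pair of highest weight vectors is
the graph of an isomorphism (`nonempty_equiv_of_isHighestWeightVector`). The central characters
exist by Schur's lemma.
-/

namespace GaugeModules

/-! ### Existence of a chart -/

theorem exists_orderEmb_linearIndependent_row {K : Type u} [Field K] {m n r : ℕ}
    (A : Matrix (Fin m) (Fin n) K) (hA : A.rank = r) :
    ∃ row : Fin r ↪o Fin m, LinearIndependent K (A.submatrix row id).row := by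
  classical
  subst hA
  rw [A.rank_eq_finrank_span_row]
  obtain ⟨f, hf, -, hli⟩ := Submodule.exists_fun_fin_finrank_span_eq K (Set.range A.row)
  choose g hg using hf
  have hgf : f = A.row ∘ g := funext fun i => (hg i).symm
  have hginj : Function.Injective g := fun a b hab =>
    hli.injective (by rw [← hg a, ← hg b, hab])
  let s : Finset (Fin m) := Finset.univ.image g
  have hs : s.card = Module.finrank K (Submodule.span K (Set.range A.row)) := by
    rw [Finset.card_image_of_injective _ hginj, Finset.card_univ, Fintype.card_fin]
  refine ⟨s.orderEmbOfFin hs, ?_⟩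
  have hmem : ∀ i, ∃ j, g j = s.orderEmbOfFin hs i := fun i => by
    obtain ⟨j, -, hj⟩ := Finset.mem_image.mp (s.orderEmbOfFin_mem hs i)
    exact ⟨j, hj⟩
  choose φ hφ using hmem
  have hφinj : Function.Injective φ := fun a b hab =>
    (s.orderEmbOfFin hs).injective (by rw [← hφ a, ← hφ b, hab])
  have : (A.submatrix (s.orderEmbOfFin hs) id).row = f ∘ φ := by
    funext i
    simp only [hgf, Function.comp_apply, hφ]
    rfl
  rw [this]
  exact hli.comp φ hφinj

/-- A matrix over a field has a non-zero minor of size equal to its rank. -/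
theorem exists_minor_ne_zero {K : Type u} [Field K] {m n r : ℕ}
    (A : Matrix (Fin m) (Fin n) K) (hA : A.rank = r) :
    ∃ (row : Fin r ↪o Fin m) (col : Fin r ↪o Fin n), (A.submatrix row col).det ≠ 0 := by
  obtain ⟨row, hrow⟩ := exists_orderEmb_linearIndependent_row A hA
  have hr : (A.submatrix row id).transpose.rank = r := by
    rw [Matrix.rank_transpose, hrow.rank_matrix, Fintype.card_fin]
  obtain ⟨col, hcol⟩ := exists_orderEmb_linearIndependent_row _ hr
  refine ⟨row, col, ?_⟩
  rw [← Matrix.det_transpose]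
  have := Matrix.linearIndependent_rows_iff_isUnit.mp hcol
  exact ((Matrix.isUnit_iff_isUnit_det _).mp this).ne_zero

namespace SmoothAffineVariety

variable {K : Type u} [Field K] {n m N : ℕ} (V : SmoothAffineVariety K n m N)

theorem isDomain_A : IsDomain V.A :=
  haveI := V.irreducible
  Ideal.Quotient.isDomain _

/-- The standard atlas is not empty: a minor of the Jacobian matrix that does not vanish at some
point of the variety defines a chart. -/
theorem nonempty_chart : Nonempty V.Chart := by
  classical
  obtain ⟨x, hx⟩ : V.X.Nonempty := by
    by_contra h
    rw [Set.not_nonempty_iff_eq_empty] at h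
    exact V.irreducible.ne_top (by rw [h, MvPolynomial.vanishingIdeal_empty])
  have hrk := V.smooth x hx
  obtain ⟨row, col, hdet⟩ := exists_minor_ne_zero
    (Matrix.of fun (j : Fin m) (i : Fin n) => MvPolynomial.eval x (MvPolynomial.pderiv i (V.g j)))
    (r := n - N) (by omega)
  let s : Finset (Fin n) := (Finset.univ.image col)ᶜ
  have hs : s.card = N := by
    rw [Finset.card_compl, Finset.card_image_of_injective _ col.injective, Finset.card_univ,
      Fintype.card_fin, Fintype.card_fin]
    omega
  refine ⟨⟨row, col, s.orderEmbOfFin hs, ?_, ?_⟩⟩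
  · rw [Finset.range_orderEmbOfFin]
    simpa [s] using (isCompl_compl (x := Set.range col)).symm
  · intro h0
    let ev : V.A →+* K := Ideal.Quotient.lift _ (MvPolynomial.eval x) fun f hf => by
      rw [← MvPolynomial.coe_aeval_eq_eval]
      exact hf x hx
    apply hdet
    have := congrArg ev h0
    rw [map_zero, RingHom.map_det] at this
    rw [← this]
    rfl

end SmoothAffineVariety

/-! ### Local vector fields on `A_(h) ⊗ U` -/

/-- The relations between the matrix units that characterise the exterior powers of the natural
module: `E_{pi}E_{qj} + E_{qi}E_{pj} = δ_{ip}E_{qj} + δ_{iq}E_{pj}` on `U`. In `⋀ K^N`, where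
`E_{pi}` is "create `p`, annihilate `i`", they are the canonical anticommutation relations. -/
def ExteriorRelations (K : Type u) [Field K] (N : ℕ) (U : Type v) [AddCommGroup U]
    [LieRingModule (Gl K N) U] : Prop :=
  ∀ (p q i j : Fin N) (x : U),
    ⁅matrixUnit K N p i, ⁅matrixUnit K N q j, x⁆⁆ + ⁅matrixUnit K N q i, ⁅matrixUnit K N p j, x⁆⁆ =
      (if i = p then ⁅matrixUnit K N q j, x⁆ else 0) +
        (if i = q then ⁅matrixUnit K N p j, x⁆ else 0)

/-- If `X` and `Y` are first-order differential operators with symbols `S` and `T`, that is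
`X (H * x r) = x r • X H + H • S r` and likewise for `Y`, then the second difference of the
composition `X F (Y G y)` in the directions `x p` and `x q` is linear over the functions. -/
theorem second_difference {R Y ι : Type*} [CommRing R] [AddCommGroup Y] [Module R Y]
    (X X' : R → Y → Y) (S T : ι → Y → Y) (x δ : ι → R)
    (hadd : ∀ H y z, X H (y + z) = X H y + X H z)
    (hX : ∀ H r z, X (H * x r) z = x r • X H z + H • S r z)
    (hX' : ∀ H r z, X' (H * x r) z = x r • X' H z + H • T r z)
    (hsmul : ∀ H r z, X H (x r • z) = x r • X H z + (H * δ r) • z)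
    (hS : ∀ r (H : R) z, S r (H • z) = H • S r z) (hSadd : ∀ r y z, S r (y + z) = S r y + S r z)
    (p q : ι) (F G : R) (y : Y) :
    X (F * x p * x q) (X' G y) - X (F * x p) (X' (G * x q) y) - X (F * x q) (X' (G * x p) y) +
      X F (X' (G * x p * x q) y) =
    (F * G) • (δ p • T q y + δ q • T p y - S p (T q y) - S q (T p y)) := by
  simp only [hX, hX', hadd, hsmul, hS, hSadd, mul_smul]
  simp only [smul_comm G (x _), smul_add, hsmul]
  module

namespace SmoothAffineVariety.Chart

variable {K : Type u} [Field K] {n m N : ℕ} {V : SmoothAffineVariety K n m N} (C : V.Chart)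
variable {U : Type v} [AddCommGroup U] [Module K U]

theorem nabla_smul (D : Fin N → Derivation K C.Ah C.Ah)
    (B : Fin N → C.Ah ⊗[K] U →ₗ[C.Ah] C.Ah ⊗[K] U) (i : Fin N) (F : C.Ah) (y : C.Ah ⊗[K] U) :
    C.nabla D B i (F • y) = D i F • y + F • C.nabla D B i y := by
  have h : LinearMap.rTensor U (D i : C.Ah →ₗ[K] C.Ah) (F • y) =
      D i F • y + F • LinearMap.rTensor U (D i : C.Ah →ₗ[K] C.Ah) y := by
    induction y with
    | zero => simp
    | tmul g u =>
      simp only [TensorProduct.smul_tmul', LinearMap.rTensor_tmul, smul_eq_mul,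
        Derivation.coeFn_coe, Derivation.leibniz, TensorProduct.add_tmul]
      rw [add_comm, mul_comm g]
    | add y z hy hz => rw [smul_add, map_add, hy, hz, map_add, smul_add, smul_add]; abel
  simp only [nabla, LinearMap.add_apply, h, LinearMap.restrictScalars_apply, map_smul, smul_add]
  abel

variable [LieRingModule (Gl K N) U] [LieModule K (Gl K N) U]

theorem rho_smul (x : Gl K N) (F : C.Ah) (y : C.Ah ⊗[K] U) :
    C.rho x (F • y) = F • C.rho x y := by
  induction y with
  | zero => simp
  | tmul g u => simp [rho, TensorProduct.smul_tmul']
  | add y z hy hz => rw [smul_add, map_add, hy, hz, map_add, smul_add]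

/-- The action on `A_(h) ⊗ U` of the vector field `F ∂/∂t_i` with coefficient `F ∈ A_(h)`. -/
noncomputable def localAct (D : Fin N → Derivation K C.Ah C.Ah)
    (B : Fin N → C.Ah ⊗[K] U →ₗ[C.Ah] C.Ah ⊗[K] U) (i : Fin N) (F : C.Ah) (y : C.Ah ⊗[K] U) :
    C.Ah ⊗[K] U :=
  F • C.nabla D B i y + ∑ p : Fin N, D p F • C.rho (matrixUnit K N p i) y

variable {C} {D : Fin N → Derivation K C.Ah C.Ah} {B : Fin N → C.Ah ⊗[K] U →ₗ[C.Ah] C.Ah ⊗[K] U}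

theorem localAct_add (i : Fin N) (F : C.Ah) (y z : C.Ah ⊗[K] U) :
    C.localAct D B i F (y + z) = C.localAct D B i F y + C.localAct D B i F z := by
  simp only [localAct, map_add, smul_add, Finset.sum_add_distrib]
  abel

theorem localAct_smul (i : Fin N) (F G : C.Ah) (y : C.Ah ⊗[K] U) :
    C.localAct D B i F (G • y) = G • C.localAct D B i F y + (F * D i G) • y := by
  simp only [localAct, nabla_smul, rho_smul, smul_add, Finset.smul_sum, smul_smul, mul_comm G]
  abel

theorem localAct_mul_param (hD : C.IsPartials D) (i p : Fin N) (F : C.Ah) (y : C.Ah ⊗[K] U) :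
    C.localAct D B i (F * algebraMap V.A C.Ah (C.t p)) y =
      algebraMap V.A C.Ah (C.t p) • C.localAct D B i F y +
        F • C.rho (matrixUnit K N p i) y := by
  simp only [localAct, Derivation.leibniz, hD _ p, smul_eq_mul, add_smul,
    Finset.sum_add_distrib, smul_add, Finset.smul_sum, smul_smul]
  rw [Finset.sum_eq_single p (fun b _ hb => by simp [hb]) (by simp)]
  simp only [if_true, mul_one, mul_comm _ F]
  abel

variable (C) in
/-- The operator `δ_{ip}E_{qj} + δ_{iq}E_{pj} - E_{pi}E_{qj} - E_{qi}E_{pj}` on `A_(h) ⊗ U`. -/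
noncomputable def exteriorDefect (p q i j : Fin N) : C.Ah ⊗[K] U →ₗ[K] C.Ah ⊗[K] U :=
  (if i = p then C.rho (matrixUnit K N q j) else 0) +
    (if i = q then C.rho (matrixUnit K N p j) else 0) -
    C.rho (matrixUnit K N p i) ∘ₗ C.rho (matrixUnit K N q j) -
    C.rho (matrixUnit K N q i) ∘ₗ C.rho (matrixUnit K N p j)

theorem exteriorDefect_smul (p q i j : Fin N) (F : C.Ah) (y : C.Ah ⊗[K] U) :
    C.exteriorDefect p q i j (F • y) = F • C.exteriorDefect p q i j y := by
  unfold exteriorDefect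
  split_ifs <;> simp only [LinearMap.sub_apply, LinearMap.add_apply, LinearMap.comp_apply,
    rho_smul, smul_sub, smul_add, LinearMap.zero_apply, smul_zero]

/-- Contracting the composition `(F ∂/∂t_i)(G ∂/∂t_j)` with the function
`(t_p ⊗ 1 - 1 ⊗ t_p)(t_q ⊗ 1 - 1 ⊗ t_q)`, which vanishes to second order on the diagonal,
removes all derivatives: what remains is the `A_(h)`-linear operator `exteriorDefect`. -/
theorem localAct_second_difference (hD : C.IsPartials D) (p q i j : Fin N) (F G : C.Ah)
    (y : C.Ah ⊗[K] U) :
    let x : Fin N → C.Ah := fun r => algebraMap V.A C.Ah (C.t r)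
    C.localAct D B i (F * x p * x q) (C.localAct D B j G y) -
      C.localAct D B i (F * x p) (C.localAct D B j (G * x q) y) -
      C.localAct D B i (F * x q) (C.localAct D B j (G * x p) y) +
      C.localAct D B i F (C.localAct D B j (G * x p * x q) y) =
    (F * G) • C.exteriorDefect p q i j y := by
  intro x
  rw [second_difference (C.localAct D B i) (C.localAct D B j)
    (fun r => C.rho (matrixUnit K N r i)) (fun r => C.rho (matrixUnit K N r j)) x
    (fun r => if i = r then 1 else 0) (localAct_add i) (fun H r z => ?_) (fun H r z => ?_)
    (fun H r z => ?_) (fun r H z => rho_smul C _ H z) (fun r z z' => map_add _ z z')]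
  · simp only [exteriorDefect, LinearMap.sub_apply, LinearMap.add_apply, LinearMap.comp_apply]
    congr 2
    split_ifs <;> simp
  · exact localAct_mul_param hD i r H z
  · exact localAct_mul_param hD j r H z
  · rw [localAct_smul, hD i r]

/-- Since `A` is finitely generated, derivations of `A_(h)` become vector fields on the variety
after multiplication by a common denominator `s`. -/
theorem exists_clear_denominators (D : Fin N → Derivation K C.Ah C.Ah) :
    ∃ s : V.A, IsUnit (algebraMap V.A C.Ah s) ∧ ∃ d : Fin N → V.Vect, ∀ i a,
      algebraMap V.A C.Ah (d i a) = algebraMap V.A C.Ah s * D i (algebraMap V.A C.Ah a) := by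
  have := V.isDomain_A
  have hinj : Function.Injective (algebraMap V.A C.Ah) :=
    IsLocalization.injective (M := Submonoid.powers C.h) C.Ah
      (powers_le_nonZeroDivisors_of_noZeroDivisors C.ne_zero)
  obtain ⟨s, hs⟩ := IsLocalization.exist_integer_multiples_of_finite (Submonoid.powers C.h)
    fun ij : Fin N × Fin n => D ij.1 (algebraMap V.A C.Ah (V.coord ij.2))
  have key : ∀ (i : Fin N) (a : V.A), ∃ b : V.A,
      algebraMap V.A C.Ah b = algebraMap V.A C.Ah s * D i (algebraMap V.A C.Ah a) := by
    intro i a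
    obtain ⟨f, rfl⟩ := Ideal.Quotient.mk_surjective a
    induction f using MvPolynomial.induction_on with
    | C c =>
      refine ⟨0, ?_⟩
      have : algebraMap V.A C.Ah (Ideal.Quotient.mk _ (MvPolynomial.C c)) =
          algebraMap K C.Ah c := by
        rw [IsScalarTower.algebraMap_apply K V.A C.Ah]
        rfl
      rw [this, Derivation.map_algebraMap, mul_zero, map_zero]
    | add f g hf hg =>
      obtain ⟨b, hb⟩ := hf
      obtain ⟨c, hc⟩ := hg
      exact ⟨b + c, by rw [map_add, map_add, map_add, map_add, hb, hc, mul_add]⟩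
    | mul_X f j hf =>
      obtain ⟨b, hb⟩ := hf
      obtain ⟨c, hc⟩ := hs (i, j)
      rw [Algebra.smul_def] at hc
      refine ⟨Ideal.Quotient.mk _ f * c + V.coord j * b, ?_⟩
      rw [map_mul (Ideal.Quotient.mk _), map_mul (algebraMap V.A C.Ah), Derivation.leibniz,
        map_add, map_mul, map_mul, hb, hc]
      simp only [smul_eq_mul, coord]
      ring
  choose f hf using key
  have hsmul : ∀ (c : K) (a : V.A), algebraMap V.A C.Ah (c • a) = c • algebraMap V.A C.Ah a :=
    fun c a => by rw [Algebra.algebraMap_eq_smul_one, smul_assoc, ← Algebra.algebraMap_eq_smul_one]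
  refine ⟨s, IsLocalization.map_units C.Ah s, fun i => Derivation.mk'
    { toFun := f i
      map_add' := fun a b => hinj (by simp only [map_add, hf, mul_add])
      map_smul' := fun c a => hinj (by
        have := (D i).map_smul c (algebraMap V.A C.Ah a)
        rw [RingHom.id_apply, hf, hsmul, hsmul, this, mul_smul_comm, hf]) }
    fun a b => hinj (by
      simp only [LinearMap.coe_mk, AddHom.coe_mk, hf, map_mul, map_add, smul_eq_mul,
        Derivation.leibniz]
      ring), fun i a => hf i a⟩

theorem gaugeAct_smul_clear_denominators (hD : C.IsPartials D) {s : V.A} {d : Fin N → V.Vect}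
    (hd : ∀ i a, algebraMap V.A C.Ah (d i a) =
      algebraMap V.A C.Ah s * D i (algebraMap V.A C.Ah a))
    (i : Fin N) (a : V.A) (y : C.Ah ⊗[K] U) :
    C.gaugeAct D B (a • d i) y = C.localAct D B i (algebraMap V.A C.Ah (a * s)) y := by
  have h : ∀ r, algebraMap V.A C.Ah ((a • d i) (C.t r)) =
      if i = r then algebraMap V.A C.Ah (a * s) else 0 := fun r => by
    rw [Derivation.smul_apply, smul_eq_mul, map_mul, hd, hD i r, map_mul]
    split_ifs <;> simp
  unfold gaugeAct
  rw [Finset.sum_eq_single i]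
  · simp only [h, if_true]
    rfl
  · intro r _ hr
    simp only [h, if_neg (Ne.symm hr), zero_smul, map_zero, Finset.sum_const_zero, add_zero]
  · simp

end SmoothAffineVariety.Chart

namespace SmoothAffineVariety

variable {K : Type u} [Field K] {n m N : ℕ} {V : SmoothAffineVariety K n m N}

/-! ### Simple gauge modules that are reducible over vector fields -/

section Reducible

variable {M : Type w} [AddCommGroup M] [Module K M] [Module V.A M] [LieRingModule V.Vect M]

/-- A proper invariant subspace `W` of a simple `AV`-module contains no `A`-submodule: the
largest `A`-submodule inside `W` is invariant under vector fields. -/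
theorem eq_zero_of_smul_mem (hAV : V.IsAVModule M) (hM : V.IsSimpleAV M) {W : Submodule K M}
    (hW : ∀ (η : V.Vect), ∀ x ∈ W, ⁅η, x⁆ ∈ W) (hW' : W ≠ ⊤) {x : M}
    (hx : ∀ a : V.A, a • x ∈ W) : x = 0 := by
  let W₀ : Submodule V.A M :=
    { carrier := {y | ∀ a : V.A, a • y ∈ W}
      add_mem' := fun hy hz a => by rw [smul_add]; exact W.add_mem (hy a) (hz a)
      zero_mem' := fun a => by rw [smul_zero]; exact W.zero_mem
      smul_mem' := fun c y hy a => by rw [smul_smul]; exact hy _ }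
  have hinv : ∀ (η : V.Vect), ∀ y ∈ W₀, ⁅η, y⁆ ∈ W₀ := fun η y hy a => by
    rw [← add_sub_cancel_left (η a • y) (a • ⁅η, y⁆), ← hAV.leibniz]
    exact W.sub_mem (hW η _ (hy a)) (hy _)
  rcases hM.2 W₀ hinv with h | h
  · have : x ∈ W₀ := hx
    rwa [h, Submodule.mem_bot] at this
  · refine absurd (eq_top_iff.mpr fun y _ => ?_) hW'
    have : y ∈ W₀ := h ▸ Submodule.mem_top
    simpa using this 1

/-- An `A`-linear map on a simple `AV`-module that vanishes on a non-zero invariant subspace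
vanishes: the `A`-span of the subspace is invariant under vector fields. -/
theorem linearMap_eq_zero_of_invariant (hAV : V.IsAVModule M) (hM : V.IsSimpleAV M)
    {W : Submodule K M} (hW : ∀ (η : V.Vect), ∀ x ∈ W, ⁅η, x⁆ ∈ W) (hW' : W ≠ ⊥)
    {Y : Type*} [AddCommGroup Y] [Module V.A Y] (τ : M →ₗ[V.A] Y) (hτ : ∀ x ∈ W, τ x = 0) :
    τ = 0 := by
  have hinv : ∀ (η : V.Vect), ∀ x ∈ Submodule.span V.A (W : Set M),
      ⁅η, x⁆ ∈ Submodule.span V.A (W : Set M) := fun η x hx => by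
    induction hx using Submodule.span_induction with
    | mem x hx => exact Submodule.subset_span (hW η x hx)
    | zero => rw [lie_zero]; exact Submodule.zero_mem _
    | add x y _ _ hx hy => rw [lie_add]; exact Submodule.add_mem _ hx hy
    | smul a x hx hx' =>
      rw [hAV.leibniz]
      exact Submodule.add_mem _ (Submodule.smul_mem _ _ hx) (Submodule.smul_mem _ _ hx')
  have htop : Submodule.span V.A (W : Set M) = ⊤ := by
    refine (hM.2 _ hinv).resolve_left fun h => hW' ?_
    rw [Submodule.span_eq_bot] at h
    exact (Submodule.eq_bot_iff W).mpr h
  have : Submodule.span V.A (W : Set M) ≤ LinearMap.ker τ := Submodule.span_le.mpr hτ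
  rw [htop, top_le_iff] at this
  exact LinearMap.ker_eq_top.mp this

/-- If the operators `S a` on a simple `AV`-module `M` that is reducible over vector fields
preserve all invariant subspaces, and `S a` is `a` times an `A`-linear map `τ` (after the
embedding `e`, and up to a function `s` that acts injectively), then `τ = 0`. -/
theorem linearMap_eq_zero_of_isReducibleVect (hAV : V.IsAVModule M) (hM : V.IsSimpleAV M)
    (hred : V.IsReducibleVect M) {Y : Type*} [AddCommGroup Y] [Module V.A Y]
    (e : M →ₗ[V.A] Y) (he : Function.Injective e) (τ : M →ₗ[V.A] Y) (S : V.A → M → M) (s : V.A)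
    (hs : ∀ y : Y, s • y = 0 → y = 0)
    (hS : ∀ W : Submodule K M, (∀ (η : V.Vect), ∀ x ∈ W, ⁅η, x⁆ ∈ W) → ∀ a, ∀ x ∈ W, S a x ∈ W)
    (heS : ∀ a x, e (S a x) = (a * s) • τ x) : τ = 0 := by
  obtain ⟨W, hW, hWbot, hWtop⟩ := hred
  have hSsmul : ∀ a x, S a x = a • S 1 x := fun a x => he (by
    rw [map_smul, heS, heS, smul_smul, one_mul])
  refine linearMap_eq_zero_of_invariant hAV hM hW hWbot τ fun x hx => hs _ ?_
  have h0 : S 1 x = 0 := eq_zero_of_smul_mem hAV hM hW hWtop fun a =>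
    hSsmul a x ▸ hS W hW a x hx
  rw [← one_mul s, ← heS, h0, map_zero]

end Reducible

namespace Chart

variable {C : V.Chart}
variable {U : Type v} [AddCommGroup U] [Module K U] [LieRingModule (Gl K N) U]
  [LieModule K (Gl K N) U]
variable {D : Fin N → Derivation K C.Ah C.Ah} {B : Fin N → C.Ah ⊗[K] U →ₗ[C.Ah] C.Ah ⊗[K] U}

variable (C U) in
/-- The operator `exteriorDefect` as an `A`-linear map. -/
noncomputable def exteriorDefectₗ (p q i j : Fin N) : C.Ah ⊗[K] U →ₗ[V.A] C.Ah ⊗[K] U :=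
  { toFun := C.exteriorDefect p q i j
    map_add' := map_add _
    map_smul' := fun a y => by
      rw [RingHom.id_apply, ← algebraMap_smul C.Ah a y, exteriorDefect_smul, algebraMap_smul] }

/-- The action of `gl_N` on `A_(h) ⊗ U` in terms of the matrix units. -/
theorem rho_eq_sum (x : Gl K N) (y : C.Ah ⊗[K] U) :
    C.rho x y = ∑ p, ∑ i, x p i • C.rho (matrixUnit K N p i) y := by
  have hx : x = ∑ p, ∑ i, x p i • matrixUnit K N p i := by
    conv_lhs => rw [Matrix.matrix_eq_sum_single x]
    simp [matrixUnit, Matrix.smul_single]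
  let ρ : Gl K N →ₗ[K] Module.End K (C.Ah ⊗[K] U) :=
    LinearMap.lTensorHom C.Ah ∘ₗ (LieModule.toEnd K (Gl K N) U : Gl K N →ₗ[K] Module.End K U)
  have h : ρ x y = ρ (∑ p, ∑ i, x p i • matrixUnit K N p i) y := by rw [← hx]
  simp only [map_sum, map_smul, LinearMap.sum_apply, LinearMap.smul_apply] at h
  exact h

/-- On a local gauge module that is simple over `AV` and reducible over vector fields, the
operators `exteriorDefect` vanish. Applied to an invariant subspace `W`, any function multiple of
such an operator is, up to an invertible function, a combination of products of two vector
fields, so it maps `W` to itself. -/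
theorem exteriorDefect_eq_zero (hD : C.IsPartials D)
    {M : Type w} [AddCommGroup M] [Module K M] [Module V.A M] [LieRingModule V.Vect M]
    (hAV : V.IsAVModule M) (hM : V.IsSimpleAV M) (hred : V.IsReducibleVect M)
    {L : Submodule V.A (C.Ah ⊗[K] U)} (e : M ≃ₗ[V.A] L)
    (he : ∀ (η : V.Vect) (x : M), ((e ⁅η, x⁆ : L) : C.Ah ⊗[K] U) = C.gaugeAct D B η (e x))
    (p q i j : Fin N) {y : C.Ah ⊗[K] U} (hy : y ∈ L) : C.exteriorDefect p q i j y = 0 := by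
  obtain ⟨s, hs, d, hd⟩ := exists_clear_denominators D
  let S : V.A → M → M := fun a x =>
    ⁅(a * C.t p * C.t q) • d i, ⁅(1 : V.A) • d j, x⁆⁆ - ⁅(a * C.t p) • d i, ⁅C.t q • d j, x⁆⁆ -
      ⁅(a * C.t q) • d i, ⁅C.t p • d j, x⁆⁆ + ⁅a • d i, ⁅(C.t p * C.t q) • d j, x⁆⁆
  have heS : ∀ a x, (e (S a x) : C.Ah ⊗[K] U) =
      (a * (s * s)) • C.exteriorDefectₗ U p q i j (e x : C.Ah ⊗[K] U) := fun a x => by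
    rw [← algebraMap_smul C.Ah (a * (s * s)), ← mul_assoc, map_mul]
    refine Eq.trans ?_ (localAct_second_difference (B := B) hD p q i j _ _ _)
    simp only [S, map_add, map_sub, Submodule.coe_add, Submodule.coe_sub, he,
      gaugeAct_smul_clear_denominators hD hd, ← map_mul, one_mul]
    simp only [mul_right_comm a _ s, mul_right_comm _ (C.t q) s, mul_comm _ s]
  have hτ := linearMap_eq_zero_of_isReducibleVect hAV hM hred (L.subtype ∘ₗ e.toLinearMap)
    (L.injective_subtype.comp e.injective)
    (C.exteriorDefectₗ U p q i j ∘ₗ L.subtype ∘ₗ e.toLinearMap) S (s * s)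
    (fun z hz => by
      rw [← algebraMap_smul C.Ah, map_mul] at hz
      exact ((hs.mul hs).smul_eq_zero).mp hz)
    (fun W hW a x hx => W.add_mem (W.sub_mem (W.sub_mem (hW _ _ (hW _ _ hx))
      (hW _ _ (hW _ _ hx))) (hW _ _ (hW _ _ hx))) (hW _ _ (hW _ _ hx)))
    heS
  have := LinearMap.congr_fun hτ (e.symm ⟨y, hy⟩)
  simp only [LinearMap.comp_apply, LinearEquiv.coe_coe, LinearEquiv.apply_symm_apply] at this
  exact this

/-- The `A_(h)`-span of a local gauge module is invariant under `gl_N`: the operator `E_{pi}` is,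
up to an invertible function, the difference between the actions of `t_p s ∂/∂t_i` and of
`s ∂/∂t_i` followed by multiplication by `t_p`. -/
theorem rho_mem_span (hD : C.IsPartials D) {L : Submodule V.A (C.Ah ⊗[K] U)}
    (hL : ∀ η : V.Vect, ∀ y ∈ L, C.gaugeAct D B η y ∈ L) (x : Gl K N) {y : C.Ah ⊗[K] U}
    (hy : y ∈ Submodule.span C.Ah (L : Set (C.Ah ⊗[K] U))) :
    C.rho x y ∈ Submodule.span C.Ah (L : Set (C.Ah ⊗[K] U)) := by
  obtain ⟨s, hs, d, hd⟩ := exists_clear_denominators D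
  have hunit : ∀ (p i : Fin N), ∀ z ∈ L, C.rho (matrixUnit K N p i) z ∈
      Submodule.span C.Ah (L : Set (C.Ah ⊗[K] U)) := fun p i z hz => by
    have h1 := L.sub_mem (hL (C.t p • d i) z hz) (L.smul_mem (C.t p) (hL ((1 : V.A) • d i) z hz))
    rw [gaugeAct_smul_clear_denominators hD hd, gaugeAct_smul_clear_denominators hD hd,
      mul_comm, map_mul, localAct_mul_param hD, one_mul, algebraMap_smul, add_sub_cancel_left]
      at h1
    obtain ⟨r, hr⟩ := hs
    rw [← hr] at h1
    have h2 := Submodule.smul_mem _ (↑r⁻¹ : C.Ah) (Submodule.subset_span (R := C.Ah) h1)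
    rwa [smul_smul, Units.inv_mul, one_smul] at h2
  induction hy using Submodule.span_induction with
  | mem y hy =>
    rw [rho_eq_sum]
    refine Submodule.sum_mem _ fun p _ => Submodule.sum_mem _ fun i _ => ?_
    rw [← algebraMap_smul C.Ah (x p i)]
    exact Submodule.smul_mem _ _ (hunit p i y hy)
  | zero => rw [map_zero]; exact Submodule.zero_mem _
  | add y z _ _ hy hz => rw [map_add]; exact Submodule.add_mem _ hy hz
  | smul F y _ hy => rw [rho_smul]; exact Submodule.smul_mem _ _ hy

/-- The relations descend from a non-zero `gl_N`-invariant subspace of `A_(h) ⊗ U` to the simple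
module `U`: the components with respect to a basis of `A_(h)` are `gl_N`-equivariant. -/
theorem exteriorRelations_of_exteriorDefect [LieModule.IsIrreducible K (Gl K N) U]
    (Y : Submodule K (C.Ah ⊗[K] U)) (hY : Y ≠ ⊥) (hrho : ∀ x, ∀ y ∈ Y, C.rho x y ∈ Y)
    (hdef : ∀ p q i j, ∀ y ∈ Y, C.exteriorDefect p q i j y = 0) : ExteriorRelations K N U := by
  classical
  obtain ⟨y, hy, hy0⟩ := Submodule.exists_mem_ne_zero_of_ne_bot hY
  obtain ⟨π, hπ, hπy⟩ : ∃ π : C.Ah ⊗[K] U →ₗ[K] U,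
      (∀ x z, π (C.rho x z) = ⁅x, π z⁆) ∧ π y ≠ 0 := by
    let b := Module.Basis.ofVectorSpace K C.Ah
    let φ := TensorProduct.equivFinsuppOfBasisLeft (N := U) b
    obtain ⟨c, hc⟩ : ∃ c, φ y c ≠ 0 := by
      by_contra! h
      exact hy0 (φ.map_eq_zero_iff.mp (Finsupp.ext h))
    refine ⟨Finsupp.lapply c ∘ₗ φ.toLinearMap, fun x z => ?_, hc⟩
    induction z with
    | zero => simp
    | tmul g u => simp [φ, rho]
    | add z z' h h' => rw [map_add, map_add, h, h', map_add, lie_add]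
  let U₀ : LieSubmodule K (Gl K N) U :=
    { Y.map π with
      lie_mem := fun {x u} hu => by
        obtain ⟨z, hz, rfl⟩ := hu
        exact ⟨C.rho x z, hrho x z hz, hπ x z⟩ }
  have hU₀ : U₀ = ⊤ := by
    have hmem : π y ∈ U₀ := ⟨y, hy, rfl⟩
    have : Nontrivial U₀ := ⟨⟨⟨π y, hmem⟩, 0, fun h => hπy (congrArg Subtype.val h)⟩⟩
    exact LieSubmodule.eq_top_of_isIrreducible K (Gl K N) U U₀
  intro p q i j u
  obtain ⟨z, hz, rfl⟩ : u ∈ U₀ := hU₀ ▸ LieSubmodule.mem_top _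
  have h := congrArg π (hdef p q i j z hz)
  have hif : ∀ (P : Prop) [Decidable P] (x : Gl K N),
      π ((if P then C.rho x else 0) z) = if P then ⁅x, π z⁆ else 0 := fun P _ x => by
    split_ifs
    · exact hπ x z
    · exact map_zero π
  rw [exteriorDefect, LinearMap.sub_apply, LinearMap.sub_apply, LinearMap.add_apply,
    LinearMap.comp_apply, LinearMap.comp_apply, map_sub π, map_sub π, map_add π, map_zero π, hif,
    hif, hπ, hπ, hπ, hπ, sub_sub, sub_eq_zero] at h
  exact h.symm

end Chart

/-- A simple `gl_N`-module that has a simple gauge module which is reducible over vector fields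
satisfies the relations of the exterior powers. -/
theorem exteriorRelations_of_isReducibleVect
    {M : Type w} [AddCommGroup M] [Module K M] [Module V.A M] [LieRingModule V.Vect M]
    {U : Type v} [AddCommGroup U] [Module K U] [LieRingModule (Gl K N) U]
    [LieModule K (Gl K N) U] [LieModule.IsIrreducible K (Gl K N) U]
    (hgauge : V.IsGaugeModule M U) (hM : V.IsSimpleAV M) (hred : V.IsReducibleVect M) :
    ExteriorRelations K N U := by
  obtain ⟨C⟩ := V.nonempty_chart
  obtain ⟨D, hD, B, -, L, -, hL, e, he⟩ := hgauge.isLocal C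
  refine Chart.exteriorRelations_of_exteriorDefect (C := C)
    ((Submodule.span C.Ah (L : Set (C.Ah ⊗[K] U))).restrictScalars K) ?_
    (fun x y hy => Chart.rho_mem_span hD hL x hy) fun p q i j y hy => ?_
  · intro h
    have := hM.1
    obtain ⟨x, hx⟩ := exists_ne (0 : M)
    have hmem : (e x : C.Ah ⊗[K] U) ∈
        (Submodule.span C.Ah (L : Set (C.Ah ⊗[K] U))).restrictScalars K :=
      Submodule.subset_span (e x).2
    rw [h, Submodule.mem_bot, Submodule.coe_eq_zero] at hmem
    exact hx (e.map_eq_zero_iff.mp hmem)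
  · rw [Submodule.restrictScalars_mem] at hy
    induction hy using Submodule.span_induction with
    | mem y hy => exact Chart.exteriorDefect_eq_zero hD hgauge.isAVModule hM hred e he p q i j hy
    | zero => exact map_zero _
    | add y z _ _ hy hz => rw [map_add, hy, hz, add_zero]
    | smul F y _ hy => rw [Chart.exteriorDefect_smul, hy, smul_zero]

end SmoothAffineVariety

/-! ### The elements `Ω̂ₖ` under the exterior relations -/

section OmegaHat

variable {N : ℕ} {R : Type*} [Ring R]

/-- The sum `Ω̂ₖ` formed with arbitrary ring elements `E p i` in place of the matrix units. -/
def omegaSum (E : Fin N → Fin N → R) (k : ℕ) : R :=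
  ∑ i : Fin k → Fin N, ∑ σ : Equiv.Perm (Fin k), (List.ofFn fun l : Fin k => E (i (σ l)) (i l)).prod

theorem omegaSum_one (E : Fin N → Fin N → R) : omegaSum E 1 = ∑ p, E p p := by
  rw [omegaSum, ← (Equiv.funUnique (Fin 1) (Fin N)).symm.sum_comp]
  refine Finset.sum_congr rfl fun p _ => ?_
  simp

variable {E : Fin N → Fin N → R}

/-- Symmetrising over the first two positions, the exterior relations contract the first factor of
each monomial of `Ω̂ₖ`. -/
theorem sum_perm_prod_eq_contraction [IsAddTorsionFree R]
    (hE : ∀ p q i j, E p i * E q j + E q i * E p j =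
      (if i = p then E q j else 0) + (if i = q then E p j else 0))
    {k : ℕ} (i : Fin (k + 2) → Fin N) :
    ∑ σ : Equiv.Perm (Fin (k + 2)), (List.ofFn fun l => E (i (σ l)) (i l)).prod =
      ∑ σ : Equiv.Perm (Fin (k + 2)), if i 0 = i (σ 0) then
        (List.ofFn fun l : Fin (k + 1) => E (i (σ l.succ)) (i l.succ)).prod else 0 := by
  set f : Equiv.Perm (Fin (k + 2)) → R := fun σ => (List.ofFn fun l => E (i (σ l)) (i l)).prod
    with hf
  set g : Equiv.Perm (Fin (k + 2)) → R := fun σ => if i 0 = i (σ 0) then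
    (List.ofFn fun l : Fin (k + 1) => E (i (σ l.succ)) (i l.succ)).prod else 0 with hg
  have hswap : ∀ F : Equiv.Perm (Fin (k + 2)) → R,
      ∑ σ, F (σ * Equiv.swap 0 1) = ∑ σ, F σ := fun F =>
    Equiv.sum_comp (Equiv.mulRight (Equiv.swap (0 : Fin (k + 2)) 1)) F
  have hfix : ∀ l : Fin k, Equiv.swap (0 : Fin (k + 2)) 1 l.succ.succ = l.succ.succ := fun l =>
    Equiv.swap_apply_of_ne_of_ne (Fin.succ_ne_zero _)
      (fun h => Fin.succ_ne_zero l (Fin.succ_injective _ h))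
  have key : ∀ σ, f σ + f (σ * Equiv.swap 0 1) = g σ + g (σ * Equiv.swap 0 1) := fun σ => by
    have h := hE (i (σ 0)) (i (σ 1)) (i 0) (i 1)
    simp only [hf, hg, List.ofFn_succ, List.prod_cons, Equiv.Perm.mul_apply, hfix,
      Equiv.swap_apply_left, Fin.succ_zero_eq_one, Equiv.swap_apply_right, ← mul_assoc]
    rw [← add_mul, h, add_mul, ite_mul, ite_mul, zero_mul]
  have h2 : (2 : ℕ) • ∑ σ, f σ = (2 : ℕ) • ∑ σ, g σ := by
    rw [two_nsmul, two_nsmul]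
    nth_rewrite 2 [← hswap f]
    nth_rewrite 2 [← hswap g]
    rw [← Finset.sum_add_distrib, ← Finset.sum_add_distrib]
    exact Finset.sum_congr rfl fun σ _ => key σ
  exact nsmul_right_injective two_ne_zero h2

/-- After the contraction, the sum over the first index and over the place where it recurs
contributes `N` (free first index) plus `k + 1` (one for each of the remaining places). -/
theorem omegaSum_succ [IsAddTorsionFree R]
    (hE : ∀ p q i j, E p i * E q j + E q i * E p j =
      (if i = p then E q j else 0) + (if i = q then E p j else 0)) (k : ℕ) :
    omegaSum E (k + 2) = (N + k + 1) • omegaSum E (k + 1) := by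
  have hmono : ∀ i : Fin (k + 2) → Fin N,
      ∑ σ : Equiv.Perm (Fin (k + 2)), (List.ofFn fun l => E (i (σ l)) (i l)).prod =
        ∑ p : Fin (k + 2), if i 0 = i p then ∑ τ : Equiv.Perm (Fin (k + 1)),
          (List.ofFn fun l => E (i (τ l).succ) (i l.succ)).prod else 0 := fun i => by
    rw [sum_perm_prod_eq_contraction hE, ← Equiv.Perm.decomposeFin.symm.sum_comp,
      Fintype.sum_prod_type]
    refine Finset.sum_congr rfl fun p _ => ?_
    simp only [Equiv.Perm.decomposeFin_symm_apply_zero, Equiv.Perm.decomposeFin_symm_apply_succ]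
    split_ifs with h
    · have hsw : ∀ r, i (Equiv.swap 0 p r) = i r := fun r => by
        rw [Equiv.swap_apply_def]
        split_ifs with h1 h2
        · rw [h1, h]
        · rw [h2, h]
        · rfl
      simp only [hsw]
    · exact Finset.sum_const_zero
  unfold omegaSum
  simp only [hmono]
  rw [← (Fin.consEquiv fun _ : Fin (k + 2) => Fin N).sum_comp, Fintype.sum_prod_type_right,
    Finset.smul_sum]
  refine Finset.sum_congr rfl fun t _ => ?_
  -- The first index is either free, or equal to one of the `k + 1` remaining indices.
  simp only [Fin.consEquiv_apply, Fin.cons_zero, Fin.cons_succ]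
  rw [Finset.sum_comm, Fin.sum_univ_succ]
  simp only [Fin.cons_zero, Fin.cons_succ, if_true, Finset.sum_const, Finset.card_univ,
    Fintype.card_fin, Finset.sum_ite_eq', Finset.mem_univ]
  rw [add_assoc, add_smul N, add_smul k 1]

end OmegaHat

section Action

variable {K : Type u} [Field K] {N : ℕ}
variable {U : Type v} [AddCommGroup U] [Module K U] [LieRingModule (Gl K N) U]
  [LieModule K (Gl K N) U]

theorem actU_unitU (p i : Fin N) :
    actU K N U (unitU K N p i) = LieModule.toEnd K (Gl K N) U (matrixUnit K N p i) :=
  UniversalEnvelopingAlgebra.lift_ι_apply K _ _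

theorem actU_OmegaHat (k : ℕ) : actU K N U (OmegaHat K N k) =
    omegaSum (fun p i => LieModule.toEnd K (Gl K N) U (matrixUnit K N p i)) k := by
  simp only [OmegaHat, omegaSum, map_sum, map_list_prod, List.map_ofFn, Function.comp_def,
    actU_unitU]

theorem actU_Omega1_apply (x : U) :
    actU K N U (Omega1 K N) x = ∑ p, ⁅matrixUnit K N p p, x⁆ := by
  simp only [Omega1, map_sum, actU_unitU, LinearMap.sum_apply, LieModule.toEnd_apply_apply]

theorem actU_OmegaHat_eq_smul [CharZero K] (h : ExteriorRelations K N U) (k : ℕ) :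
    actU K N U (OmegaHat K N (k + 1)) =
      (((N + k).factorial : K) / (N.factorial : K)) • actU K N U (Omega1 K N) := by
  let _ : Module ℚ (Module.End K U) := Module.compHom _ (algebraMap ℚ K)
  have : IsAddTorsionFree (Module.End K U) := IsAddTorsionFree.of_module_rat _
  have hE : ∀ p q i j : Fin N,
      LieModule.toEnd K (Gl K N) U (matrixUnit K N p i) *
          LieModule.toEnd K (Gl K N) U (matrixUnit K N q j) +
        LieModule.toEnd K (Gl K N) U (matrixUnit K N q i) *
          LieModule.toEnd K (Gl K N) U (matrixUnit K N p j) =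
      (if i = p then LieModule.toEnd K (Gl K N) U (matrixUnit K N q j) else 0) +
        (if i = q then LieModule.toEnd K (Gl K N) U (matrixUnit K N p j) else 0) := by
    intro p q i j
    ext x
    have := h p q i j x
    split_ifs at this ⊢ <;> simpa using this
  have hN : (N.factorial : K) ≠ 0 := Nat.cast_ne_zero.mpr N.factorial_ne_zero
  induction k with
  | zero =>
    rw [actU_OmegaHat, omegaSum_one, Nat.add_zero, div_self hN, one_smul, Omega1, map_sum]
    simp only [actU_unitU]
  | succ k ih =>
    rw [actU_OmegaHat, omegaSum_succ hE, ← actU_OmegaHat, ih, ← Nat.cast_smul_eq_nsmul K,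
      smul_smul, ← add_assoc, Nat.factorial_succ]
    congr 1
    push_cast
    ring

theorem actsByScalar_P [CharZero K] (h : ExteriorRelations K N U) {k : ℕ} (hk : 2 ≤ k) :
    ActsByScalar K N U (P K N k) 0 := fun x => by
  obtain ⟨k, rfl⟩ : ∃ j, k = j + 1 := ⟨k - 1, by omega⟩
  rw [P, map_sub, map_smul, actU_OmegaHat_eq_smul h, ← add_assoc, Nat.add_sub_cancel, sub_self,
    LinearMap.zero_apply, zero_smul]

end Action

variable {K : Type u} [Field K] {N : ℕ}

/-! ### Modules generated by a highest weight vector -/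

section Weights

theorem lie_matrixUnit_matrixUnit (p i q j : Fin N) :
    ⁅matrixUnit K N p i, matrixUnit K N q j⁆ =
      (if i = q then matrixUnit K N p j else 0) - (if j = p then matrixUnit K N q i else 0) := by
  rw [LieRing.of_associative_ring_bracket]
  simp only [matrixUnit]
  congr 1
  · split_ifs with h
    · rw [h, Matrix.single_mul_single_same, one_mul]
    · rw [Matrix.single_mul_single_of_ne _ _ _ _ h]
  · split_ifs with h
    · rw [h, Matrix.single_mul_single_same, one_mul]
    · rw [Matrix.single_mul_single_of_ne _ _ _ _ h]

theorem matrixUnit_lie_matrixUnit_lie {U : Type v} [AddCommGroup U] [LieRingModule (Gl K N) U]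
    (p i q j : Fin N) (x : U) :
    ⁅matrixUnit K N p i, ⁅matrixUnit K N q j, x⁆⁆ =
      ⁅matrixUnit K N q j, ⁅matrixUnit K N p i, x⁆⁆ +
        ((if i = q then ⁅matrixUnit K N p j, x⁆ else 0) -
          (if j = p then ⁅matrixUnit K N q i, x⁆ else 0)) := by
  rw [leibniz_lie, lie_matrixUnit_matrixUnit, sub_lie, add_comm]
  congr 2 <;> split_ifs <;> simp

variable {U : Type v} [AddCommGroup U] [Module K U] [LieRingModule (Gl K N) U]
  [LieModule K (Gl K N) U]

/-- A subspace closed under the matrix units is closed under `gl_N`. -/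
theorem lie_mem_of_matrixUnit {W : Submodule K U} {x : U}
    (h : ∀ p i, ⁅matrixUnit K N p i, x⁆ ∈ W) (A : Gl K N) : ⁅A, x⁆ ∈ W := by
  have hA : A = ∑ p, ∑ i, A p i • matrixUnit K N p i := by
    conv_lhs => rw [Matrix.matrix_eq_sum_single A]
    simp [matrixUnit, Matrix.smul_single]
  rw [hA, ← LieModule.toEnd_apply_apply K]
  simp only [map_sum, map_smul, LinearMap.sum_apply, LinearMap.smul_apply,
    LieModule.toEnd_apply_apply]
  exact Submodule.sum_mem _ fun p _ => Submodule.sum_mem _ fun i _ => W.smul_mem _ (h p i)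

/-- The element `∑ p·E_{pp}` of the Cartan subalgebra, which grades `gl_N`. -/
def gradingElement (K : Type u) [Field K] (N : ℕ) : Gl K N :=
  ∑ p : Fin N, ((p : ℕ) : K) • matrixUnit K N p p

theorem gradingElement_lie (x : U) :
    ⁅gradingElement K N, x⁆ = ∑ p : Fin N, ((p : ℕ) : K) • ⁅matrixUnit K N p p, x⁆ := by
  rw [gradingElement, ← LieModule.toEnd_apply_apply K]
  simp only [map_sum, map_smul, LinearMap.sum_apply, LinearMap.smul_apply,
    LieModule.toEnd_apply_apply]

theorem gradingElement_lie_matrixUnit_lie (p i : Fin N) (x : U) :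
    ⁅gradingElement K N, ⁅matrixUnit K N p i, x⁆⁆ =
      ⁅matrixUnit K N p i, ⁅gradingElement K N, x⁆⁆ +
        (((p : ℕ) : K) - ((i : ℕ) : K)) • ⁅matrixUnit K N p i, x⁆ := by
  simp only [gradingElement_lie, matrixUnit_lie_matrixUnit_lie _ _ p i x, lie_sum, lie_smul,
    smul_add, smul_sub, Finset.sum_add_distrib, Finset.sum_sub_distrib, smul_ite, smul_zero,
    Finset.sum_ite_eq', Finset.sum_ite_eq, Finset.mem_univ, if_true, sub_smul]

/-- `v` has weight `∑_{p ∈ S} ε_p`: each `E_{pp}` fixes `v` if `p ∈ S` and kills it otherwise. -/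
def HasWeight (S : Finset (Fin N)) (v : U) : Prop :=
  ∀ p, ⁅matrixUnit K N p p, v⁆ = if p ∈ S then v else 0

/-- `v` has weight `∑_{p ∈ S} ε_p` and is killed by the matrix units above the diagonal. -/
structure IsHighestWeightVector (S : Finset (Fin N)) (v : U) : Prop where
  weight : HasWeight (K := K) S v
  upper : ∀ p i : Fin N, p < i → ⁅matrixUnit K N p i, v⁆ = 0

/-- The set of vectors obtained from `v` by repeatedly applying matrix units below the diagonal. -/
inductive LoweringWord (K : Type u) [Field K] (N : ℕ) {U : Type v} [AddCommGroup U]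
    [LieRingModule (Gl K N) U] (v : U) : U → Prop
  | base : LoweringWord K N v v
  | step (p i : Fin N) (hip : i < p) (y : U) (hy : LoweringWord K N v y) :
      LoweringWord K N v ⁅matrixUnit K N p i, y⁆

variable {S : Finset (Fin N)} {v : U}

/-- The span of the lowering words is closed under all matrix units: those that are not lowering are
commuted to the right until they reach `v`. -/
theorem LoweringWord.matrixUnit_lie_mem_span (hv : IsHighestWeightVector (K := K) S v) {y : U}
    (hy : LoweringWord K N v y) :
    ∀ p i, ⁅matrixUnit K N p i, y⁆ ∈ Submodule.span K {z | LoweringWord K N v z} := by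
  induction hy with
  | base =>
    intro p i
    rcases lt_trichotomy p i with h | rfl | h
    · rw [hv.upper p i h]
      exact Submodule.zero_mem _
    · rw [hv.weight p]
      split_ifs
      · exact Submodule.subset_span .base
      · exact Submodule.zero_mem _
    · exact Submodule.subset_span (LoweringWord.step p i h _ .base)
  | step q j hjq y hy ih =>
    intro p i
    rw [matrixUnit_lie_matrixUnit_lie]
    refine Submodule.add_mem _ ?_ (Submodule.sub_mem _ ?_ ?_)
    · have h := ih p i
      generalize ⁅matrixUnit K N p i, y⁆ = w at h ⊢
      induction h using Submodule.span_induction with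
      | mem z hz => exact Submodule.subset_span (LoweringWord.step q j hjq z hz)
      | zero => rw [lie_zero]; exact Submodule.zero_mem _
      | add z z' _ _ hz hz' => rw [lie_add]; exact Submodule.add_mem _ hz hz'
      | smul c z _ hz => rw [lie_smul]; exact Submodule.smul_mem _ _ hz
    · split_ifs
      · exact ih p j
      · exact Submodule.zero_mem _
    · split_ifs
      · exact ih q i
      · exact Submodule.zero_mem _

/-- The submodule generated by a highest weight vector. -/
def highestWeightSubmodule (hv : IsHighestWeightVector (K := K) S v) :
    LieSubmodule K (Gl K N) U :=
  { Submodule.span K {z | LoweringWord K N v z} with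
    lie_mem := fun {A x} hx => by
      refine lie_mem_of_matrixUnit (fun p i => ?_) A
      have hx' : x ∈ Submodule.span K {z | LoweringWord K N v z} := hx
      induction hx' using Submodule.span_induction with
      | mem z hz => exact LoweringWord.matrixUnit_lie_mem_span hv hz p i
      | zero => rw [lie_zero]; exact Submodule.zero_mem _
      | add z z' hz₀ hz₁ hz hz' =>
        rw [lie_add]; exact Submodule.add_mem _ (hz hz₀) (hz' hz₁)
      | smul c z hz₀ hz => rw [lie_smul]; exact Submodule.smul_mem _ _ (hz hz₀) }

theorem mem_highestWeightSubmodule (hv : IsHighestWeightVector (K := K) S v) {x : U} :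
    x ∈ highestWeightSubmodule hv ↔ x ∈ Submodule.span K {z | LoweringWord K N v z} :=
  Iff.rfl

theorem self_mem_highestWeightSubmodule (hv : IsHighestWeightVector (K := K) S v) :
    v ∈ highestWeightSubmodule hv :=
  Submodule.subset_span LoweringWord.base

theorem HasWeight.gradingElement_lie (hv : HasWeight (K := K) S v) :
    ⁅gradingElement K N, v⁆ = ((∑ p ∈ S, (p : ℕ) : ℕ) : K) • v := by
  have hv' : ∀ p, ⁅matrixUnit K N p p, v⁆ = if p ∈ S then v else 0 := hv
  rw [GaugeModules.gradingElement_lie]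
  simp only [hv', smul_ite, smul_zero, Finset.sum_ite_mem, Finset.univ_inter]
  rw [Nat.cast_sum, Finset.sum_smul]

/-- The non-trivial lowering words have degree strictly larger than that of `v`. -/
theorem LoweringWord.exists_degree {c : K} (hv : ⁅gradingElement K N, v⁆ = c • v) {y : U}
    (hy : LoweringWord K N v y) :
    ∃ m : ℕ, ⁅gradingElement K N, y⁆ = (c + (m : K)) • y ∧ (m = 0 → y = v) := by
  induction hy with
  | base => exact ⟨0, by rw [hv, Nat.cast_zero, add_zero], fun _ => rfl⟩
  | step p i hip y _ ih =>
    obtain ⟨m, hm, -⟩ := ih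
    refine ⟨m + ((p : ℕ) - (i : ℕ)), ?_, fun h => ?_⟩
    · rw [gradingElement_lie_matrixUnit_lie, hm, lie_smul, ← add_smul, Nat.cast_add,
        Nat.cast_sub (Fin.lt_def.mp hip).le]
      congr 1
      ring
    · have := Fin.lt_def.mp hip
      omega

/-- In the module generated by a highest weight vector `v`, the vectors of the same degree as `v`
are the multiples of `v`. -/
theorem exists_smul_eq_of_mem_highestWeightSubmodule [CharZero K]
    (hv : IsHighestWeightVector (K := K) S v) {x : U} (hx : x ∈ highestWeightSubmodule hv) {c : K}
    (hc : ⁅gradingElement K N, v⁆ = c • v) (hxc : ⁅gradingElement K N, x⁆ = c • x) :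
    ∃ a : K, x = a • v := by
  let H : Module.End K U := LieModule.toEnd K (Gl K N) U (gradingElement K N)
  have hH : ∀ y, H y = ⁅gradingElement K N, y⁆ := fun y => rfl
  let G : Submodule K U := ⨆ μ : K, ⨆ _ : μ ≠ c, H.eigenspace μ
  have hdec : ∃ a : K, x - a • v ∈ G := by
    rw [mem_highestWeightSubmodule] at hx
    clear hxc
    induction hx using Submodule.span_induction with
    | mem z hz =>
      obtain ⟨m, hm, hm0⟩ := LoweringWord.exists_degree hc hz
      rcases Nat.eq_zero_or_pos m with h | h
      · exact ⟨1, by rw [hm0 h, one_smul, sub_self]; exact Submodule.zero_mem _⟩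
      · refine ⟨0, ?_⟩
        rw [zero_smul, sub_zero]
        have hne : c + (m : K) ≠ c := fun h' => h.ne' (by simpa using h')
        exact Submodule.mem_iSup_of_mem _ (Submodule.mem_iSup_of_mem hne
          (Module.End.mem_eigenspace_iff.mpr ((hH z).trans hm)))
    | zero => exact ⟨0, by simp⟩
    | add z z' _ _ hz hz' =>
      obtain ⟨a, ha⟩ := hz
      obtain ⟨b, hb⟩ := hz'
      refine ⟨a + b, ?_⟩
      rw [add_smul, add_sub_add_comm]
      exact Submodule.add_mem _ ha hb
    | smul d z _ hz =>
      obtain ⟨a, ha⟩ := hz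
      refine ⟨d * a, ?_⟩
      rw [mul_smul, ← smul_sub]
      exact Submodule.smul_mem _ _ ha
  obtain ⟨a, ha⟩ := hdec
  refine ⟨a, sub_eq_zero.mp ?_⟩
  have hE : x - a • v ∈ H.eigenspace c := Submodule.sub_mem _
    (Module.End.mem_eigenspace_iff.mpr hxc)
    (Submodule.smul_mem _ _ (Module.End.mem_eigenspace_iff.mpr hc))
  exact Submodule.disjoint_def.mp ((Module.End.eigenspaces_iSupIndep H) c) _ hE ha

end Weights

/-! ### Simple modules with the same highest weight are isomorphic -/

section Uniqueness

variable {S : Finset (Fin N)}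

/-- The submodule generated by `v` in `Y ⊆ U × U'` projects injectively to `U`: otherwise it
contains `(0, ψ v)`, which has the same degree as `v` and is not a multiple of `v`. -/
theorem injOn_highestWeightSubmodule [CharZero K] {Y U U' : Type v}
    [AddCommGroup Y] [Module K Y] [LieRingModule (Gl K N) Y] [LieModule K (Gl K N) Y]
    [AddCommGroup U] [Module K U] [LieRingModule (Gl K N) U]
    [AddCommGroup U'] [Module K U'] [LieRingModule (Gl K N) U']
    [LieModule.IsIrreducible K (Gl K N) U']
    (φ : Y →ₗ⁅K, Gl K N⁆ U) (ψ : Y →ₗ⁅K, Gl K N⁆ U')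
    (hφψ : ∀ y, φ y = 0 → ψ y = 0 → y = 0) {v : Y} (hv : IsHighestWeightVector (K := K) S v)
    (hφ : φ v ≠ 0) (hψ : ψ v ≠ 0) {y : Y} (hy : y ∈ highestWeightSubmodule hv) (hy0 : φ y = 0) :
    y = 0 := by
  by_contra hne
  let Q : LieSubmodule K (Gl K N) U' := (highestWeightSubmodule hv ⊓ φ.ker).map ψ
  have hQ : Q = ⊤ := by
    have hmem : ψ y ∈ Q := LieSubmodule.mem_map_of_mem ⟨hy, φ.mem_ker.mpr hy0⟩
    have : Nontrivial Q :=
      ⟨⟨⟨ψ y, hmem⟩, 0, fun h => hne (hφψ y hy0 (congrArg Subtype.val h))⟩⟩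
    exact LieSubmodule.eq_top_of_isIrreducible K (Gl K N) U' Q
  have hmem : ψ v ∈ Q := hQ ▸ LieSubmodule.mem_top _
  obtain ⟨q, ⟨hq, hqφ⟩, hqψ⟩ := (LieSubmodule.mem_map _).mp hmem
  have hqφ' : φ q = 0 := φ.mem_ker.mp hqφ
  have hdeg := hv.weight.gradingElement_lie
  obtain ⟨a, rfl⟩ := exists_smul_eq_of_mem_highestWeightSubmodule hv hq hdeg <| by
    rw [← sub_eq_zero]
    refine hφψ _ ?_ ?_
    · rw [map_sub, LieModuleHom.map_lie, map_smul, hqφ', lie_zero, smul_zero, sub_zero]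
    · rw [map_sub, LieModuleHom.map_lie, map_smul, hqψ, ← LieModuleHom.map_lie, hdeg, map_smul,
        sub_self]
  rw [map_smul, smul_eq_zero, or_iff_left hφ] at hqφ'
  rw [hqφ', zero_smul, map_zero] at hqψ
  exact hψ hqψ.symm

variable {U U' : Type v} [AddCommGroup U] [Module K U] [LieRingModule (Gl K N) U]
  [LieModule K (Gl K N) U] [AddCommGroup U'] [Module K U'] [LieRingModule (Gl K N) U']
  [LieModule K (Gl K N) U']

/-- The diagonal action of a Lie algebra on a product of two modules. -/
instance prodLieRingModule : LieRingModule (Gl K N) (U × U') where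
  bracket A y := (⁅A, y.1⁆, ⁅A, y.2⁆)
  add_lie A B y := Prod.ext (add_lie A B y.1) (add_lie A B y.2)
  lie_add A y z := Prod.ext (lie_add A y.1 z.1) (lie_add A y.2 z.2)
  leibniz_lie A B y := Prod.ext (leibniz_lie A B y.1) (leibniz_lie A B y.2)

instance prodLieModule : LieModule K (Gl K N) (U × U') where
  smul_lie c A y := Prod.ext (smul_lie c A y.1) (smul_lie c A y.2)
  lie_smul c A y := Prod.ext (lie_smul c A y.1) (lie_smul c A y.2)

theorem nonempty_equiv_of_isHighestWeightVector [CharZero K]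
    [LieModule.IsIrreducible K (Gl K N) U] [LieModule.IsIrreducible K (Gl K N) U']
    {v : U} {v' : U'} (hv : IsHighestWeightVector (K := K) S v)
    (hv' : IsHighestWeightVector (K := K) S v') (h0 : v ≠ 0) (h0' : v' ≠ 0) :
    Nonempty (U ≃ₗ⁅K, Gl K N⁆ U') := by
  let φ : (U × U') →ₗ⁅K, Gl K N⁆ U := { LinearMap.fst K U U' with map_lie' := rfl }
  let ψ : (U × U') →ₗ⁅K, Gl K N⁆ U' := { LinearMap.snd K U U' with map_lie' := rfl }
  have hw : IsHighestWeightVector (K := K) S (v, v') :=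
    ⟨fun p => by
      refine Prod.ext ((hv.weight p).trans ?_) ((hv'.weight p).trans ?_) <;> split_ifs <;> rfl,
    fun p i h => Prod.ext (hv.upper p i h) (hv'.upper p i h)⟩
  let Z := highestWeightSubmodule hw
  have hZ : (v, v') ∈ Z := self_mem_highestWeightSubmodule hw
  let f : Z →ₗ⁅K, Gl K N⁆ U := φ.comp Z.incl
  let g : Z →ₗ⁅K, Gl K N⁆ U' := ψ.comp Z.incl
  have hf : Function.Bijective f := by
    refine ⟨(injective_iff_map_eq_zero _).mpr fun z hz => Subtype.ext
      (injOn_highestWeightSubmodule φ ψ (fun y h h' => Prod.ext h h') hw h0 h0' z.2 hz), ?_⟩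
    have : Nontrivial f.range := ⟨⟨⟨v, ⟨(v, v'), hZ⟩, rfl⟩, 0, fun h => h0 (congrArg Subtype.val h)⟩⟩
    rw [← LieModuleHom.range_eq_top]
    exact LieSubmodule.eq_top_of_isIrreducible K (Gl K N) U f.range
  have hg : Function.Bijective g := by
    refine ⟨(injective_iff_map_eq_zero _).mpr fun z hz => Subtype.ext
      (injOn_highestWeightSubmodule ψ φ (fun y h h' => Prod.ext h' h) hw h0' h0 z.2 hz), ?_⟩
    have : Nontrivial g.range :=
      ⟨⟨⟨v', ⟨(v, v'), hZ⟩, rfl⟩, 0, fun h => h0' (congrArg Subtype.val h)⟩⟩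
    rw [← LieModuleHom.range_eq_top]
    exact LieSubmodule.eq_top_of_isIrreducible K (Gl K N) U' g.range
  let ef : Z ≃ₗ⁅K, Gl K N⁆ U :=
    { LinearEquiv.ofBijective (f : Z →ₗ[K] U) hf with map_lie' := fun {A x} => f.map_lie A x }
  let eg : Z ≃ₗ⁅K, Gl K N⁆ U' :=
    { LinearEquiv.ofBijective (g : Z →ₗ[K] U') hg with map_lie' := fun {A x} => g.map_lie A x }
  exact ⟨ef.symm.trans eg⟩

end Uniqueness

/-! ### Highest weights under the exterior relations -/

namespace ExteriorRelations

variable {U : Type v} [AddCommGroup U] [LieRingModule (Gl K N) U]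

/-- `E_{pi}` moves the weight of `S` to that of `S ∪ {p} \ {i}`, and it is injective there because
`E_{ip} E_{pi} = E_{ii} (1 - E_{pp})`. -/
theorem hasWeight_matrixUnit_lie (h : ExteriorRelations K N U) {S : Finset (Fin N)} {v : U}
    (hv : v ≠ 0) (hw : HasWeight (K := K) S v) {p i : Fin N} (hp : p ∉ S) (hi : i ∈ S) :
    ⁅matrixUnit K N p i, v⁆ ≠ 0 ∧
      HasWeight (K := K) (insert p (S.erase i)) ⁅matrixUnit K N p i, v⁆ := by
  have hpi : p ≠ i := fun e => hp (e ▸ hi)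
  have hwp := hw p
  have hwi := hw i
  rw [if_neg hp] at hwp
  rw [if_pos hi] at hwi
  refine ⟨fun h0 => hv ?_, fun q => ?_⟩
  · have := h i p p i v
    rwa [h0, hwi, hwp, lie_zero, add_zero, if_neg hpi, if_pos rfl, zero_add, eq_comm] at this
  · rw [matrixUnit_lie_matrixUnit_lie, hw q]
    by_cases hqp : q = p
    · subst hqp
      simp [hp, hpi.symm]
    · by_cases hqi : q = i
      · subst hqi
        simp [hi, hqp]
      · have hqi' : i ≠ q := fun e => hqi e.symm
        by_cases hq : q ∈ S <;> simp [hqp, hqi, hqi', hq]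

variable [CharZero K] [Module K U]

theorem diag_idem (h : ExteriorRelations K N U) (p : Fin N) (x : U) :
    ⁅matrixUnit K N p p, ⁅matrixUnit K N p p, x⁆⁆ = ⁅matrixUnit K N p p, x⁆ := by
  have := h p p p p x
  rw [if_pos rfl, ← two_smul K, ← two_smul K] at this
  exact smul_right_injective U two_ne_zero this

/-- By idempotency, the `E_{pp}` have no eigenvalues besides `0` and `1`. -/
theorem eq_zero_of_diag_lie (h : ExteriorRelations K N U) {p : Fin N} {c : K} (hc0 : c ≠ 0)
    (hc1 : c ≠ 1) [LieModule K (Gl K N) U] {x : U} (hx : ⁅matrixUnit K N p p, x⁆ = c • x) :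
    x = 0 := by
  have h1 := h.diag_idem p x
  rw [hx, lie_smul, hx, ← sub_eq_zero, ← smul_sub, smul_eq_zero, or_iff_right hc0] at h1
  nth_rewrite 2 [← one_smul K x] at h1
  rw [← sub_smul, smul_eq_zero, or_iff_right (sub_ne_zero.mpr hc1)] at h1
  exact h1

theorem exists_hasWeight (h : ExteriorRelations K N U) [Nontrivial U] :
    ∃ (S : Finset (Fin N)) (v : U), v ≠ 0 ∧ HasWeight (K := K) S v := by
  classical
  have key : ∀ T : Finset (Fin N), ∃ v : U, v ≠ 0 ∧
      ∀ p ∈ T, ⁅matrixUnit K N p p, v⁆ = v ∨ ⁅matrixUnit K N p p, v⁆ = 0 := by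
    intro T
    induction T using Finset.induction_on with
    | empty =>
      obtain ⟨v, hv⟩ := exists_ne (0 : U)
      exact ⟨v, hv, by simp⟩
    | insert q T hq ih =>
      obtain ⟨v, hv, hT⟩ := ih
      by_cases h0 : ⁅matrixUnit K N q q, v⁆ = 0
      · exact ⟨v, hv, fun p hp => (Finset.mem_insert.mp hp).elim (fun e => e ▸ Or.inr h0) (hT p)⟩
      · refine ⟨_, h0, fun p hp => ?_⟩
        rcases Finset.mem_insert.mp hp with rfl | hp
        · exact Or.inl (h.diag_idem p v)
        · have hpq : p ≠ q := fun e => hq (e ▸ hp)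
          rw [matrixUnit_lie_matrixUnit_lie, if_neg hpq, if_neg hpq.symm, sub_zero, add_zero]
          rcases hT p hp with e | e
          · exact Or.inl (by rw [e])
          · exact Or.inr (by rw [e, lie_zero])
  obtain ⟨v, hv, hT⟩ := key Finset.univ
  refine ⟨Finset.univ.filter fun p => ⁅matrixUnit K N p p, v⁆ = v, v, hv, fun p => ?_⟩
  simp only [Finset.mem_filter, Finset.mem_univ, true_and]
  split_ifs with hp
  · exact hp
  · exact (hT p (Finset.mem_univ p)).resolve_left hp

/-- There is a highest weight vector, and its weight belongs to an initial segment of the index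
set: it is obtained from a weight `S` for which the sum of the elements of `S` is minimal. -/
theorem exists_isHighestWeightVector (h : ExteriorRelations K N U) [LieModule K (Gl K N) U]
    [Nontrivial U] : ∃ (S : Finset (Fin N)) (v : U), v ≠ 0 ∧
      IsHighestWeightVector (K := K) S v ∧ IsLowerSet (S : Set (Fin N)) := by
  classical
  have hex : ∃ s : ℕ, ∃ (S : Finset (Fin N)) (v : U), v ≠ 0 ∧ HasWeight (K := K) S v ∧
      ∑ p ∈ S, (p : ℕ) = s := by
    obtain ⟨S, v, hv, hw⟩ := h.exists_hasWeight
    exact ⟨_, S, v, hv, hw, rfl⟩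
  obtain ⟨S, v, hv, hw, hs⟩ := Nat.find_spec hex
  have hmin : ∀ p i : Fin N, p < i → p ∉ S → i ∉ S := fun p i hpi hp hi => by
    obtain ⟨hne, hw'⟩ := h.hasWeight_matrixUnit_lie hv hw hp hi
    refine Nat.find_min hex (m := ∑ q ∈ insert p (S.erase i), (q : ℕ)) ?_ ⟨_, _, hne, hw', rfl⟩
    rw [← hs, Finset.sum_insert (fun hm => hp (Finset.mem_of_mem_erase hm)),
      ← Finset.add_sum_erase S _ hi]
    exact Nat.add_lt_add_right (Fin.lt_def.mp hpi) _
  refine ⟨S, v, hv, ⟨hw, fun p i hpi => ?_⟩, fun i p hpi hi => ?_⟩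
  · have hww : ∀ q, ⁅matrixUnit K N q q, v⁆ = if q ∈ S then v else 0 := hw
    by_cases hp : p ∈ S
    · -- `E_{pp}` would have eigenvalue `2` on `E_{pi} v`.
      refine h.eq_zero_of_diag_lie (p := p) (c := 2) two_ne_zero (by norm_num) ?_
      rw [matrixUnit_lie_matrixUnit_lie, hww, if_pos hp, if_pos rfl, if_neg hpi.ne', sub_zero,
        two_smul]
    · -- `E_{ii}` would have eigenvalue `-1` on `E_{pi} v`.
      refine h.eq_zero_of_diag_lie (p := i) (c := -1) (by norm_num) (by norm_num) ?_
      rw [matrixUnit_lie_matrixUnit_lie, hww, if_neg (hmin p i hpi hp), if_neg hpi.ne', if_pos rfl,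
        lie_zero, zero_sub, zero_add, neg_one_smul]
  · rcases hpi.eq_or_lt with rfl | hlt
    · exact hi
    · by_contra hp
      exact hmin p i hlt hp hi

end ExteriorRelations

/-! ### Schur's lemma and central characters -/

section Scalars

variable {U : Type v} [AddCommGroup U] [Module K U] [LieRingModule (Gl K N) U]
  [LieModule K (Gl K N) U]

/-- An endomorphism of a simple module that has an eigenvector is a scalar. -/
theorem eq_smul_of_commute [LieModule.IsIrreducible K (Gl K N) U] (f : Module.End K U)
    (hf : ∀ (A : Gl K N) (x : U), f ⁅A, x⁆ = ⁅A, f x⁆) {v : U} {c : K} (hv : v ≠ 0)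
    (hvc : f v = c • v) (x : U) : f x = c • x := by
  let Q : LieSubmodule K (Gl K N) U :=
    { f.eigenspace c with
      lie_mem := fun {A y} hy => by
        have hy' : f y = c • y := Module.End.mem_eigenspace_iff.mp hy
        exact Module.End.mem_eigenspace_iff.mpr (by rw [hf, hy', lie_smul]) }
  have hmem : v ∈ Q := Module.End.mem_eigenspace_iff.mpr hvc
  have : Nontrivial Q := ⟨⟨⟨v, hmem⟩, 0, fun h => hv (congrArg Subtype.val h)⟩⟩
  have hx : x ∈ Q := LieSubmodule.eq_top_of_isIrreducible K (Gl K N) U Q ▸ LieSubmodule.mem_top _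
  exact Module.End.mem_eigenspace_iff.mp hx

theorem actU_ι (A : Gl K N) : actU K N U (UniversalEnvelopingAlgebra.ι K A) =
    LieModule.toEnd K (Gl K N) U A :=
  UniversalEnvelopingAlgebra.lift_ι_apply K _ _

theorem actU_center_lie (z : Subalgebra.center K (UGl K N)) (A : Gl K N) (x : U) :
    actU K N U (z : UGl K N) ⁅A, x⁆ = ⁅A, actU K N U (z : UGl K N) x⁆ := by
  have h := Subalgebra.mem_center_iff.mp z.2 (UniversalEnvelopingAlgebra.ι K A)
  have h' := LinearMap.congr_fun (congrArg (actU K N U) h) x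
  rw [map_mul, map_mul, actU_ι] at h'
  exact h'.symm

theorem actU_Omega1_lie (A : Gl K N) (x : U) :
    actU K N U (Omega1 K N) ⁅A, x⁆ = ⁅A, actU K N U (Omega1 K N) x⁆ := by
  have h1 : ∑ p, matrixUnit K N p p = (1 : Gl K N) := Matrix.sum_single_one
  simp only [actU_Omega1_apply, ← sum_lie, h1]
  rw [leibniz_lie A, LieRing.of_associative_ring_bracket, mul_one, one_mul, sub_self, zero_lie,
    zero_add]

theorem exists_hasCentralCharacter [IsAlgClosed K] [FiniteDimensional K U]
    [LieModule.IsIrreducible K (Gl K N) U] :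
    ∃ χ : Subalgebra.center K (UGl K N) →ₐ[K] K, HasCentralCharacter K N U χ := by
  have := LieModule.nontrivial_of_isIrreducible K (Gl K N) U
  have hz : ∀ z : Subalgebra.center K (UGl K N), ∃ c : K, ActsByScalar K N U (z : UGl K N) c := by
    intro z
    obtain ⟨c, hc⟩ := Module.End.exists_eigenvalue (actU K N U (z : UGl K N))
    obtain ⟨v, hv⟩ := hc.exists_hasEigenvector
    exact ⟨c, eq_smul_of_commute _ (actU_center_lie z) hv.2 hv.apply_eq_smul⟩
  choose χ hχ using hz
  obtain ⟨v, hv⟩ := exists_ne (0 : U)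
  have huniq : ∀ (z : Subalgebra.center K (UGl K N)) (c : K),
      actU K N U (z : UGl K N) v = c • v → χ z = c := fun z c hc =>
    smul_left_injective K hv ((hχ z v).symm.trans hc)
  exact ⟨
    { toFun := χ
      map_one' := huniq _ _ (by rw [OneMemClass.coe_one, map_one, one_smul]; rfl)
      map_mul' := fun z z' => huniq _ _ (by
        rw [MulMemClass.coe_mul, map_mul, Module.End.mul_apply, hχ z' v, map_smul, hχ z v,
          smul_smul, mul_comm])
      map_zero' := huniq _ _ (by
        rw [ZeroMemClass.coe_zero, map_zero, zero_smul, LinearMap.zero_apply])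
      map_add' := fun z z' => huniq _ _ (by
        rw [AddMemClass.coe_add, map_add, LinearMap.add_apply, hχ z v, hχ z' v, add_smul])
      commutes' := fun c => huniq _ _ (by
        rw [Subalgebra.coe_algebraMap, AlgHom.commutes, Module.algebraMap_end_apply]; rfl) }, hχ⟩

theorem HasCentralCharacter.congr {U' : Type v} [AddCommGroup U'] [Module K U']
    [LieRingModule (Gl K N) U'] [LieModule K (Gl K N) U'] (e : U ≃ₗ⁅K, Gl K N⁆ U')
    {χ : Subalgebra.center K (UGl K N) →ₐ[K] K} (h : HasCentralCharacter K N U χ) :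
    HasCentralCharacter K N U' χ := by
  have key : ((LinearEquiv.conjAlgEquiv K e.toLinearEquiv : Module.End K U ≃ₐ[K] _) :
      Module.End K U →ₐ[K] Module.End K U').comp (actU K N U) = actU K N U' := by
    refine UniversalEnvelopingAlgebra.hom_ext K (LieHom.ext fun A => LinearMap.ext fun x => ?_)
    change e (actU K N U (UniversalEnvelopingAlgebra.ι K A) (e.symm x)) =
      actU K N U' (UniversalEnvelopingAlgebra.ι K A) x
    rw [actU_ι, actU_ι, LieModule.toEnd_apply_apply, LieModule.toEnd_apply_apply]
    exact (e.toLieModuleHom.map_lie A _).trans (congrArg _ (e.apply_symm_apply x))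
  intro z x
  rw [← key]
  change e (actU K N U (z : UGl K N) (e.symm x)) = χ z • x
  rw [h z]
  exact (map_smul e.toLinearEquiv _ _).trans (congrArg _ (e.apply_symm_apply x))

end Scalars

/-! ### Classification of the exceptional modules by the scalar of `Ω₁` -/

section Classification

variable {U : Type v} [AddCommGroup U] [Module K U] [LieRingModule (Gl K N) U]
  [LieModule K (Gl K N) U] [LieModule.IsIrreducible K (Gl K N) U]

theorem HasWeight.actsByScalar_Omega1 {S : Finset (Fin N)} {v : U} (hv : v ≠ 0)
    (hw : HasWeight (K := K) S v) : ActsByScalar K N U (Omega1 K N) (S.card : K) := by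
  have hw' : ∀ p, ⁅matrixUnit K N p p, v⁆ = if p ∈ S then v else 0 := hw
  refine eq_smul_of_commute _ actU_Omega1_lie hv ?_
  rw [actU_Omega1_apply]
  simp only [hw', Finset.sum_ite_mem, Finset.univ_inter, Finset.sum_const]
  rw [Nat.cast_smul_eq_nsmul]

theorem ExteriorRelations.exists_actsByScalar_Omega1 [CharZero K] (h : ExteriorRelations K N U) :
    ∃ a : Fin (N + 1), ActsByScalar K N U (Omega1 K N) ((a : ℕ) : K) := by
  have := LieModule.nontrivial_of_isIrreducible K (Gl K N) U
  obtain ⟨S, v, hv, hw⟩ := h.exists_hasWeight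
  exact ⟨⟨S.card, Nat.lt_succ_of_le (card_finset_fin_le S)⟩, hw.actsByScalar_Omega1 hv⟩

/-- The scalar by which `Ω₁` acts determines the module: it is the size of an initial segment of
the index set that carries the highest weight. -/
theorem ExteriorRelations.nonempty_equiv [CharZero K] (h : ExteriorRelations K N U)
    {U' : Type v} [AddCommGroup U'] [Module K U'] [LieRingModule (Gl K N) U']
    [LieModule K (Gl K N) U'] [LieModule.IsIrreducible K (Gl K N) U']
    (h' : ExteriorRelations K N U') {c : K} (hc : ActsByScalar K N U (Omega1 K N) c)
    (hc' : ActsByScalar K N U' (Omega1 K N) c) : Nonempty (U ≃ₗ⁅K, Gl K N⁆ U') := by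
  have := LieModule.nontrivial_of_isIrreducible K (Gl K N) U
  have := LieModule.nontrivial_of_isIrreducible K (Gl K N) U'
  obtain ⟨S, v, hv, hw, hS⟩ := h.exists_isHighestWeightVector
  obtain ⟨S', v', hv', hw', hS'⟩ := h'.exists_isHighestWeightVector
  have hcard : S.card = S'.card := by
    have h1 := smul_left_injective K hv ((hw.weight.actsByScalar_Omega1 hv v).symm.trans (hc v))
    have h2 := smul_left_injective K hv'
      ((hw'.weight.actsByScalar_Omega1 hv' v').symm.trans (hc' v'))
    exact Nat.cast_injective (h1.trans h2.symm)
  have hSS' : S = S' := by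
    rcases hS.total hS' with hle | hle
    · exact Finset.eq_of_subset_of_card_le (Finset.coe_subset.mp hle) hcard.ge
    · exact (Finset.eq_of_subset_of_card_le (Finset.coe_subset.mp hle) hcard.le).symm
  subst hSS'
  exact nonempty_equiv_of_isHighestWeightVector hw hw' hv hv'

end Classification

namespace SimpleGlModule

theorem IsExceptional.exteriorRelations {U : SimpleGlModule.{u, v} K N}
    (hU : IsExceptional.{u, v, w} U) : ExteriorRelations K N U.carrier := by
  obtain ⟨n, m, V, M, _, _, _, _, hgauge, hM, hred⟩ := hU
  have := U.irreducible
  exact V.exteriorRelations_of_isReducibleVect hgauge hM hred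

end SimpleGlModule

/-- The trivial character of the centre of `U(gl_N)`. -/
noncomputable def trivialCentralCharacter (K : Type u) [Field K] (N : ℕ) :
    Subalgebra.center K (UGl K N) →ₐ[K] K :=
  (UniversalEnvelopingAlgebra.lift K (0 : Gl K N →ₗ⁅K⁆ K)).comp (Subalgebra.val _)

end GaugeModules

theorem corollary9 (K : Type u) [Field K] [IsAlgClosed K] [CharZero K] (N : ℕ) :
    (GaugeModules.SimpleGlModule.exceptionalClasses.{u, v, w} K N).encard ≤ N + 1 ∧
    ∃ χ : Fin (N + 1) → (Subalgebra.center K (GaugeModules.UGl K N) →ₐ[K] K),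
      ∀ U : GaugeModules.SimpleGlModule.{u, v} K N,
        GaugeModules.SimpleGlModule.IsExceptional.{u, v, w} U →
        (∀ k : ℕ, 2 ≤ k →
          GaugeModules.ActsByScalar K N U.carrier (GaugeModules.P K N k) 0) ∧
        ∃ a : Fin (N + 1),
          GaugeModules.ActsByScalar K N U.carrier (GaugeModules.Omega1 K N) ((a : ℕ) : K) ∧
          GaugeModules.HasCentralCharacter K N U.carrier (χ a) := by
  classical
  have hiso : ∀ (U U' : GaugeModules.SimpleGlModule.{u, v} K N) (a : Fin (N + 1)),
      GaugeModules.SimpleGlModule.IsExceptional.{u, v, w} U →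
      GaugeModules.SimpleGlModule.IsExceptional.{u, v, w} U' →
      GaugeModules.ActsByScalar K N U.carrier (GaugeModules.Omega1 K N) ((a : ℕ) : K) →
      GaugeModules.ActsByScalar K N U'.carrier (GaugeModules.Omega1 K N) ((a : ℕ) : K) →
      Nonempty (U.carrier ≃ₗ⁅K, GaugeModules.Gl K N⁆ U'.carrier) := by
    intro U U' a hU hU' ha ha'
    have := U.irreducible
    have := U'.irreducible
    exact hU.exteriorRelations.nonempty_equiv hU'.exteriorRelations ha ha'
  have hscalar : ∀ U : GaugeModules.SimpleGlModule.{u, v} K N,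
      GaugeModules.SimpleGlModule.IsExceptional.{u, v, w} U → ∃ a : Fin (N + 1),
        GaugeModules.ActsByScalar K N U.carrier (GaugeModules.Omega1 K N) ((a : ℕ) : K) := by
    intro U hU
    have := U.irreducible
    exact hU.exteriorRelations.exists_actsByScalar_Omega1
  constructor
  · have hclass : ∀ c : GaugeModules.SimpleGlModule.exceptionalClasses.{u, v, w} K N,
        ∃ (a : Fin (N + 1)) (U : GaugeModules.SimpleGlModule.{u, v} K N),
          GaugeModules.SimpleGlModule.IsExceptional.{u, v, w} U ∧ Quotient.mk _ U = c.1 ∧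
          GaugeModules.ActsByScalar K N U.carrier (GaugeModules.Omega1 K N) ((a : ℕ) : K) := by
      rintro ⟨c, U, hU, hUc⟩
      obtain ⟨a, ha⟩ := hscalar U hU
      exact ⟨a, U, hU, hUc, ha⟩
    choose f U hU hUc hf using hclass
    have hinj : Function.Injective f := fun c c' hcc => Subtype.ext <| by
      rw [← hUc c, ← hUc c']
      exact Quotient.sound (hiso _ _ (f c) (hU c) (hU c') (hf c) (hcc ▸ hf c'))
    have hle := ENat.card_le_card_of_injective hinj
    rw [ENat.card_eq_coe_fintype_card (α := Fin (N + 1)), Fintype.card_fin, Nat.cast_add,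
      Nat.cast_one] at hle
    exact hle
  · have hχ : ∀ a : Fin (N + 1), ∃ χ : Subalgebra.center K (GaugeModules.UGl K N) →ₐ[K] K,
        ∀ U : GaugeModules.SimpleGlModule.{u, v} K N,
          GaugeModules.SimpleGlModule.IsExceptional.{u, v, w} U →
          GaugeModules.ActsByScalar K N U.carrier (GaugeModules.Omega1 K N) ((a : ℕ) : K) →
          GaugeModules.HasCentralCharacter K N U.carrier χ := by
      intro a
      by_cases hex : ∃ U : GaugeModules.SimpleGlModule.{u, v} K N,
          GaugeModules.SimpleGlModule.IsExceptional.{u, v, w} U ∧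
          GaugeModules.ActsByScalar K N U.carrier (GaugeModules.Omega1 K N) ((a : ℕ) : K)
      · obtain ⟨U, hU, ha⟩ := hex
        have := U.irreducible
        have := U.finiteDimensional
        obtain ⟨χ, hχ⟩ := GaugeModules.exists_hasCentralCharacter (K := K) (N := N) (U := U.carrier)
        refine ⟨χ, fun U' hU' ha' => ?_⟩
        obtain ⟨e⟩ := hiso U U' a hU hU' ha ha'
        exact hχ.congr e
      · exact ⟨GaugeModules.trivialCentralCharacter K N, fun U hU ha => absurd ⟨U, hU, ha⟩ hex⟩
    choose χ hχ using hχ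
    refine ⟨χ, fun U hU =>
      ⟨fun k hk => GaugeModules.actsByScalar_P hU.exteriorRelations hk, ?_⟩⟩
    obtain ⟨a, ha⟩ := hscalar U hU
    exact ⟨a, ha, hχ a U hU ha⟩
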